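/- **Setting.** Graphs are finite and may have loops and parallel edges. A *signed graph* $(G,\sigma)$ is a graph with a signature $\sigma:E(G)\to\{+,-\}$. Two signatures are *switching equivalent* if one arises from the other by changing the signs of all edges of an edge cut. The *frustration index* $l(G,\sigma)$ is the least number of negative edges over all signatures switching equivalent to $\sigma$. $(G,\sigma)$ is *critically $k$-frustrated* if $l(G,\sigma)=k$ and $l(G\setminus e,\sigma)=k-1$ for every edge $e$. *Subdividing* a set of $t\ge 1$ parallel edges of the same sign between $x$ and $y$ (possibly $x=y$) means replacing it by a new vertex $w$, $t$ positive edges $xw$, and $t$ edges $wy$ of the original sign. $(G,\sigma)$ is *irreducible* if it does not arise from any signed graph by one or more such subdivisions. $\mathcal S^*(k)$ is the family of critically $k$-frustrated signed graphs that are irreducible and contain no two edge-disjoint negative cycles (a cycle is negative if it has an odd number of negative edges). A *canonical embedding* of $(G,\sigma)\in\mathcal S^*(k)$ presents $G$, with a signature $\pi$ switching equivalent to $\sigma$, as follows: take a 2-connected plane cubic graph $G'$ (loopless, parallel edges allowed, all edges positive) and a facial cycle $C'$ of $G'$; insert $2k$ distinct new vertices $z_1,\dots,z_{2k}$, in this cyclic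 order, on the edges of $C'$; and add $k$ negative edges $z_iz_{k+i}$ $(1\le i\le k)$, drawn through a cross cap placed in the face bounded by $C'$. The *weight* $\omega(e)$ of an edge $e$ of $C'$ is the number of vertices $z_i$ inserted on $e$. A *boundary face* is a face $F$ of $G'$, other than the one bounded by $C'$, whose boundary cycle $C_F$ shares an edge with $C'$; it is a *bridge face* if the graph $C_F\cap C'$ is disconnected. A canonical embedding is *normal* if it has no bridge face. **Proposition 2.11.** Let $(G,\sigma)\in\mathcal S^*(k)$ and fix any normal canonical embedding of it. 1. If $k=4$, then no two consecutive edges of $C'$ both have weight $0$. 2. If $k=5$, then at most $3$ edges of $C'$ in a row (in the cyclic order of $C'$) have weight $0$. -/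

import Mathlib

open scoped Graph

/-! ### Signed multigraphs

A signed graph is a multigraph `G : Graph α β` (loops and parallel edges allowed) with a signature
`σ : β → ℤˣ`; only the values of `σ` on `E(G)` matter, and `e` is negative when `σ e = -1`. -/

namespace SignedGraph

variable {α β : Type*}

/-- The set of negative edges of `(G, σ)`. -/
def negEdges (G : Graph α β) (σ : β → ℤˣ) : Set β := {e ∈ E(G) | σ e = -1}

/-- The edge cut of all edges with one end in `X` and the other end outside `X`. -/
def edgeCut (G : Graph α β) (X : Set α) : Set β := {e | ∃ x ∈ X, ∃ y ∉ X, G.IsLink e x y}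

/-- `π` is obtained from `σ` by changing the signs of all the edges of one edge cut. -/
def SwitchingEquiv (G : Graph α β) (σ π : β → ℤˣ) : Prop :=
  ∃ X : Set α, ∀ e ∈ E(G),
    (e ∈ edgeCut G X → π e = -σ e) ∧ (e ∉ edgeCut G X → π e = σ e)

/-- The frustration index: the least number of negative edges over all switching equivalent
signatures. -/
noncomputable def frustrationIndex (G : Graph α β) (σ : β → ℤˣ) : ℕ :=
  sInf {n | ∃ π, SwitchingEquiv G σ π ∧ (negEdges G π).ncard = n}

/-- `(G, σ)` is critically `k`-frustrated: its frustration index is `k`, and deleting any edge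
makes it `k - 1`. -/
def IsCritical (k : ℕ) (G : Graph α β) (σ : β → ℤˣ) : Prop :=
  frustrationIndex G σ = k ∧ ∀ e ∈ E(G), frustrationIndex (G.deleteEdges {e}) σ + 1 = k

/-- `C` is the edge set of a cycle of `G` (a loop is a cycle of length `1`, and two parallel edges
form a cycle of length `2`): the vertices `v 0, …, v (n-1)` are distinct, the edges
`e 0, …, e (n-1)` are distinct, and `e i` joins `v i` to its cyclic successor. -/
def IsCycleEdgeSet (G : Graph α β) (C : Set β) : Prop :=
  ∃ (n : ℕ) (_ : NeZero n) (v : Fin n → α) (e : Fin n → β),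
    Function.Injective v ∧ Function.Injective e ∧
    (∀ i, G.IsLink (e i) (v i) (v (i + 1))) ∧ C = Set.range e

/-- `C` is the edge set of a negative cycle: one with an odd number of negative edges. -/
def IsNegCycle (G : Graph α β) (σ : β → ℤˣ) (C : Set β) : Prop :=
  IsCycleEdgeSet G C ∧ Odd (C ∩ negEdges G σ).ncard

/-- `(G, σ)` is obtained from `(H, τ)` by subdividing a nonempty set `F` of parallel edges of one
sign between `x` and `y` (possibly `x = y`): a new vertex `w` is added, and `F` is replaced by
equally many positive edges between `x` and `w` (for which the names in `F` are reused) and equally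
many edges `B` between `w` and `y` that have the sign of `F`. -/
def IsSubdivisionStep (H : Graph α β) (τ : β → ℤˣ) (G : Graph α β) (σ : β → ℤˣ) : Prop :=
  ∃ (w x y : α) (F B : Set β) (s : ℤˣ),
    w ∉ V(H) ∧ F.Nonempty ∧ F.Finite ∧ (∀ e ∈ F, H.IsLink e x y) ∧ (∀ e ∈ F, τ e = s) ∧
    B.Finite ∧ B.ncard = F.ncard ∧ Disjoint B E(H) ∧
    V(G) = insert w V(H) ∧
    (∀ e u v, G.IsLink e u v ↔
      (e ∉ F ∧ H.IsLink e u v) ∨ (e ∈ F ∧ s(u, v) = s(x, w)) ∨ (e ∈ B ∧ s(u, v) = s(w, y))) ∧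
    (∀ e ∈ E(H), e ∉ F → σ e = τ e) ∧ (∀ e ∈ F, σ e = 1) ∧ (∀ e ∈ B, σ e = s)

/-- `(G, σ)` is irreducible: it is not a proper subdivision of any signed graph, that is, it does
not arise from one by a positive number of subdivision steps. (A subdivision has more vertices and
edges than the original, so up to renaming the original can be taken on the same types.) -/
def IsIrreducible (G : Graph α β) (σ : β → ℤˣ) : Prop :=
  ∀ (H : Graph α β) (τ : β → ℤˣ),
    ¬ Relation.TransGen
        (fun P Q : Graph α β × (β → ℤˣ) => IsSubdivisionStep P.1 P.2 Q.1 Q.2) (H, τ) (G, σ)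

/-- `(G, σ)` belongs to the family `S*(k)` of prime critically `k`-frustrated signed graphs: it is a
finite critically `k`-frustrated signed graph that is irreducible and has no two edge-disjoint
negative cycles. -/
structure MemSStar (k : ℕ) (G : Graph α β) (σ : β → ℤˣ) : Prop where
  finite_vertexSet : V(G).Finite
  finite_edgeSet : E(G).Finite
  critical : IsCritical k G σ
  irreducible : IsIrreducible G σ
  not_disjoint : ∀ C₁ C₂, IsNegCycle G σ C₁ → IsNegCycle G σ C₂ → ¬ Disjoint C₁ C₂

/-- A multigraph is connected if it has a vertex and any two vertices are joined by a walk. -/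
def IsConnected (G : Graph α β) : Prop :=
  V(G).Nonempty ∧ ∀ x ∈ V(G), ∀ y ∈ V(G), Relation.ReflTransGen G.Adj x y

/-- A multigraph is 2-connected if it is connected, has no loop and has no cut vertex. -/
def IsTwoConnected (G : Graph α β) : Prop :=
  IsConnected G ∧ (∀ e x, ¬ G.IsLoopAt e x) ∧ ∀ v ∈ V(G), IsConnected (G.deleteVerts {v})

end SignedGraph

/-! ### Plane multigraphs as rotation systems -/

/-- A combinatorial map (rotation system) on a type `D` of darts, that is, of directed edges:
`rev` reverses a dart, and `rot` permutes cyclically the darts that leave a vertex. -/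
structure CombMap (D : Type*) where
  rot : Equiv.Perm D
  rev : Equiv.Perm D
  rev_rev : ∀ d, rev (rev d) = d
  rev_ne : ∀ d, rev d ≠ d

namespace CombMap

variable {D : Type*} (M : CombMap D)

/-- The face permutation: it sends a dart to the next dart on the boundary walk of its face. -/
def face : Equiv.Perm D := M.rev.trans M.rot

/-- Vertices are the orbits of `rot`. -/
abbrev Vertex : Type _ := Quotient (Equiv.Perm.SameCycle.setoid M.rot)

/-- Edges are the orbits of `rev`, that is, the pairs `{d, rev d}`. -/
abbrev Edge : Type _ := Quotient (Equiv.Perm.SameCycle.setoid M.rev)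

/-- Faces are the orbits of `face`. -/
abbrev Face : Type _ := Quotient (Equiv.Perm.SameCycle.setoid M.face)

/-- The vertex that a dart leaves. -/
def vertexOf (d : D) : M.Vertex := Quotient.mk _ d

/-- The edge underlying a dart. -/
def edgeOf (d : D) : M.Edge := Quotient.mk _ d

/-- The face along whose boundary a dart runs. -/
def faceOf (d : D) : M.Face := Quotient.mk _ d

theorem eq_or_eq_rev_of_edgeOf_eq {d d' : D} (h : M.edgeOf d = M.edgeOf d') :
    d' = d ∨ d' = M.rev d := by
  obtain ⟨n, hn⟩ : M.rev.SameCycle d d' := Quotient.exact h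
  have h2 : M.rev ^ (2 : ℤ) = 1 := by
    ext x
    change (M.rev ^ (2 : ℕ)) x = x
    simp [sq, M.rev_rev]
  rcases Int.even_or_odd' n with ⟨m, rfl | rfl⟩
  · left
    rw [zpow_mul, h2] at hn
    simpa using hn.symm
  · right
    rw [zpow_add, zpow_mul, h2] at hn
    simpa using hn.symm

theorem edgeOf_rev (d : D) : M.edgeOf (M.rev d) = M.edgeOf d :=
  Quotient.sound ⟨1, by simp [M.rev_rev]⟩

/-- The underlying multigraph of a combinatorial map. -/
def graph : Graph M.Vertex M.Edge where
  vertexSet := Set.univ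
  IsLink e x y := ∃ d, M.edgeOf d = e ∧ M.vertexOf d = x ∧ M.vertexOf (M.rev d) = y
  isLink_symm := by
    rintro e - 
    refine ⟨?_⟩
    rintro x y ⟨d, rfl, rfl, rfl⟩
    exact ⟨M.rev d, M.edgeOf_rev d, rfl, by rw [M.rev_rev]⟩
  eq_or_eq_of_isLink_of_isLink := by
    rintro e x y v w ⟨d, rfl, rfl, rfl⟩ ⟨d', h, rfl, rfl⟩
    rcases M.eq_or_eq_rev_of_edgeOf_eq h.symm with rfl | rfl
    · exact Or.inl rfl
    · exact Or.inr (by rw [M.rev_rev])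
  left_mem_of_isLink := fun _ _ _ _ => Set.mem_univ _

/-- The map describes an embedding in the plane (on the sphere): the graph is connected and Euler's
formula `|V| + |F| = |E| + 2` holds. -/
def IsPlane : Prop :=
  SignedGraph.IsConnected M.graph ∧ Nat.card M.Vertex + Nat.card M.Face = Nat.card M.Edge + 2

/-- Every vertex has degree `3`. -/
def IsCubic : Prop := ∀ d, Function.minimalPeriod M.rot d = 3

/-- The vertices on the boundary of a face. -/
def faceVertices (f : M.Face) : Set M.Vertex := {v | ∃ d, M.faceOf d = f ∧ M.vertexOf d = v}

/-- The edges on the boundary of a face. -/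
def faceEdges (f : M.Face) : Set M.Edge := {e | ∃ d, M.faceOf d = f ∧ M.edgeOf d = e}

/-- The intersection of the boundaries of two faces, as a subgraph. -/
def faceInter (f g : M.Face) : Graph M.Vertex M.Edge :=
  (M.graph.restrict (M.faceEdges f ∩ M.faceEdges g)).induce (M.faceVertices f ∩ M.faceVertices g)

end CombMap

/-! ### Canonical embeddings -/

/-- The data behind a canonical embedding: a 2-connected plane cubic graph `map` (called `G'`), its
facial cycle `C'` that is traversed from the dart `root` on, and the positions of `2k` vertices
`z 0, …, z (2k-1)` that are inserted in this cyclic order on `C'`. The edges of `C'` are numbered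
`0, 1, …` from `root` on, and `z a` is inserted on the edge with number `pos a`; vertices `z` on the
same edge are ordered by their indices in the direction of the traversal. -/
structure CanonicalData (k : ℕ) (D : Type*) where
  map : CombMap D
  isPlane : map.IsPlane
  isCubic : map.IsCubic
  isTwoConnected : SignedGraph.IsTwoConnected map.graph
  root : D
  pos : Fin (2 * k) → Fin (Function.minimalPeriod map.face root)
  pos_mono : Monotone pos

namespace CanonicalData

variable {k : ℕ} {D : Type*} (Φ : CanonicalData k D)

/-- The face of `G'` bounded by `C'`; the cross cap is put into it. -/
def outerFace : Φ.map.Face := Φ.map.faceOf Φ.root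

/-- The dart along the `i`-th edge of `C'`, counted cyclically from the root. -/
def bdryDart (i : ℕ) : D := Φ.map.face^[i] Φ.root

/-- The vertex of `G'` at which the `i`-th edge of `C'` starts. -/
def corner (i : ℕ) : Φ.map.Vertex := Φ.map.vertexOf (Φ.bdryDart i)

/-- The weight of the edge of `C'` along a dart `d` of `C'`: the number of vertices inserted
on it. -/
noncomputable def weight (d : D) : ℕ := {a : Fin (2 * k) | Φ.bdryDart (Φ.pos a) = d}.ncard

/-- The vertices of the signed graph that is built: those of `G'` and the inserted vertices. -/
abbrev Vtx : Type _ := Φ.map.Vertex ⊕ Fin (2 * k)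

/-- The edges of the signed graph that is built: the edges of `G'` not on `C'` (`inner`), the
segments into which the edges of `C'` are subdivided, named after the vertex at which they start
(`fromCorner`, `fromPoint`), and `k` negative edges (`cross`). -/
inductive Edg : Type _
  | inner (e : Φ.map.Edge) (he : e ∉ Φ.map.faceEdges Φ.outerFace) : Edg
  | fromCorner (i : Fin (Function.minimalPeriod Φ.map.face Φ.root)) : Edg
  | fromPoint (a : Fin (2 * k)) : Edg
  | cross (a : Fin k) : Edg

/-- The sign of an edge of the signed graph that is built. -/
def sign : Φ.Edg → ℤˣ
  | .cross _ => -1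
  | _ => 1

/-- The ends of the edges of the signed graph that is built, each edge in one direction. On the
`i`-th edge of `C'` the vertices `corner i`, the `z a` with `pos a = i` in increasing order, and
`corner (i + 1)` are joined consecutively; the negative edges join `z a` and `z (a + k)`. -/
inductive Link : Φ.Edg → Φ.Vtx → Φ.Vtx → Prop
  | inner (d : D) (hd : Φ.map.edgeOf d ∉ Φ.map.faceEdges Φ.outerFace) :
      Link (.inner (Φ.map.edgeOf d) hd)
        (.inl (Φ.map.vertexOf d)) (.inl (Φ.map.vertexOf (Φ.map.rev d)))
  | corner_corner (i : Fin (Function.minimalPeriod Φ.map.face Φ.root)) (hi : ∀ a, Φ.pos a ≠ i) :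
      Link (.fromCorner i) (.inl (Φ.corner i)) (.inl (Φ.corner (i + 1)))
  | corner_point (a : Fin (2 * k)) (ha : ∀ b < a, Φ.pos b ≠ Φ.pos a) :
      Link (.fromCorner (Φ.pos a)) (.inl (Φ.corner (Φ.pos a))) (.inr a)
  | point_point (a b : Fin (2 * k)) (hab : (b : ℕ) = a + 1) (hpos : Φ.pos a = Φ.pos b) :
      Link (.fromPoint a) (.inr a) (.inr b)
  | point_corner (a : Fin (2 * k)) (ha : ∀ b > a, Φ.pos b ≠ Φ.pos a) :
      Link (.fromPoint a) (.inr a) (.inl (Φ.corner (Φ.pos a + 1)))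
  | cross (a : Fin k) :
      Link (.cross a) (.inr ⟨a, by omega⟩) (.inr ⟨a + k, by omega⟩)

/-- A boundary face: a face of `G'`, other than the one bounded by `C'`, whose boundary shares an
edge with `C'`. -/
def IsBoundaryFace (f : Φ.map.Face) : Prop :=
  f ≠ Φ.outerFace ∧ (Φ.map.faceEdges f ∩ Φ.map.faceEdges Φ.outerFace).Nonempty

/-- A bridge face: a boundary face whose boundary meets `C'` in a disconnected graph. -/
def IsBridgeFace (f : Φ.map.Face) : Prop :=
  Φ.IsBoundaryFace f ∧ ¬ SignedGraph.IsConnected (Φ.map.faceInter f Φ.outerFace)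

end CanonicalData

/-- A canonical embedding of the signed graph `(G, σ)`, with `k` negative edges in the cross cap:
canonical data together with an isomorphism from the signed graph built from them to `(G, σ)`. -/
structure CanonicalEmbedding {α β : Type*} (G : Graph α β) (σ : β → ℤˣ) (k : ℕ) (D : Type*)
    extends CanonicalData k D where
  vertexEquiv : toCanonicalData.Vtx ≃ V(G)
  edgeEquiv : toCanonicalData.Edg ≃ E(G)
  isLink_iff : ∀ e u v, G.IsLink (edgeEquiv e) (vertexEquiv u) (vertexEquiv v) ↔
    (toCanonicalData.Link e u v ∨ toCanonicalData.Link e v u)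
  sign_eq : ∀ e, σ (edgeEquiv e) = toCanonicalData.sign e

/-- A canonical embedding is normal if it has no bridge face. -/
def CanonicalEmbedding.IsNormal {α β : Type*} {G : Graph α β} {σ : β → ℤˣ} {k : ℕ} {D : Type*}
    (Φ : CanonicalEmbedding G σ k D) : Prop :=
  ∀ f, ¬ Φ.toCanonicalData.IsBridgeFace f

/-! ### Planar maps have trivial first cohomology modulo two -/

namespace CombMap

variable {D : Type*} (M : CombMap D)

/-! Cuts are described by `ZMod 2`-colourings of the vertices: a cut is the set of edges along which
a colouring changes. The signature `π` of the embedding has exactly `k` negative edges, hence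
attains the frustration index. So no cut has more negative than positive edges, and criticality puts
every positive edge into an equilibrated cut, one with equally many of both
(`exists_equilibrated_cut`). Euler's formula identifies the cuts of `G'` with the even subgraphs of
its dual (`exists_coboundary_eq`).

Let `b`, `c` be consecutive edges of `C'` of weight 0, let `g` be the inner edge at their common
end, and take an equilibrated cut through `g`. It contains neither `b` nor `c`: otherwise moving the
common end to the other side would lose positive edges but no negative ones. By normality a boundary
face has only one edge on `C'`, so in the dual the cut leaves the faces across `b` and `c` through
further inner edges `t₁` and `t₂`. The inner edges of an equilibrated cut contain no dual cycle,
since dropping it would again lose only positive edges (`false_of_faceSum_eq_zero`). Hence `g`,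
`t₁`, `t₂` are distinct; with at least two segments of `C'` they make five positive edges against at
most `k` negative ones, so `5 ≤ k`. This settles `k = 4`. For `k = 5` there is equality throughout:
`t₁` and `t₂` lead to boundary faces at two segments of `C'` that together separate all five
opposite pairs (`exists_opposite_cuts`).

Now let `k = 5` and let the edges 0, 1, 2, 3 of `C'` have weight 0. For `j = 0, 1, 2` there are cuts
with one inner edge from edge `j` to a segment `p` and from edge `j + 1` to a segment `q`, with `p`
and `q` five inserted points apart. Counting points from the run of weight-0 edges on, the cut
inequality and uncrossing force `p` to come after 7 or 8 points. Uncrossing the cuts to `p` for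
successive `j` shows that this number strictly decreases with `j`, which is impossible for three
values in `{7, 8}` (`not_four_weights_eq_zero`). -/

theorem face_apply (d : D) : M.face d = M.rot (M.rev d) := rfl

theorem face_rev (d : D) : M.face (M.rev d) = M.rot d := by
  rw [face_apply, M.rev_rev]

theorem vertexOf_rot (d : D) : M.vertexOf (M.rot d) = M.vertexOf d :=
  Quotient.sound ⟨-1, by simp⟩

theorem faceOf_face (d : D) : M.faceOf (M.face d) = M.faceOf d :=
  Quotient.sound ⟨-1, by simp⟩

theorem vertexOf_face (d : D) : M.vertexOf (M.face d) = M.vertexOf (M.rev d) := by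
  rw [face_apply, vertexOf_rot]

theorem faceOf_rot (d : D) : M.faceOf (M.rot d) = M.faceOf (M.rev d) := by
  rw [← face_rev, faceOf_face]

theorem fun_add_self {ι : Type*} (x : ι → ZMod 2) : x + x = 0 := by
  ext i
  exact CharTwo.add_self_eq_zero _

theorem finrank_span_singleton_le {V : Type*} [AddCommGroup V] [Module (ZMod 2) V] (v : V) :
    Module.finrank (ZMod 2) (Submodule.span (ZMod 2) {v}) ≤ 1 := by
  simpa using finrank_span_le_card (R := ZMod 2) ({v} : Set V)

/-- An equivalence relation that is respected by a permutation step is respected along orbits. -/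
theorem rel_of_sameCycle {D : Type*} {p : Equiv.Perm D} {r : D → D → Prop} (hr : Equivalence r)
    (h : ∀ d, r d (p d)) {d d' : D} (hd : p.SameCycle d d') : r d d' := by
  obtain ⟨n, rfl⟩ := hd
  induction n using Int.induction_on with
  | zero => exact hr.refl _
  | succ n ih =>
    rw [add_comm, zpow_add, zpow_one, Equiv.Perm.mul_apply]
    exact hr.trans ih (h _)
  | pred n ih =>
    refine hr.trans ih (hr.symm ?_)
    have h1 := h ((p ^ (-(n : ℤ) - 1)) d)
    rwa [← Equiv.Perm.mul_apply, ← zpow_one_add, show 1 + (-(n : ℤ) - 1) = -n by ring] at h1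

/-- The change of a vertex colouring along an edge. -/
noncomputable def coboundary : (M.Vertex → ZMod 2) →ₗ[ZMod 2] (M.Edge → ZMod 2) where
  toFun x e := x (M.vertexOf e.out) + x (M.vertexOf (M.rev e.out))
  map_add' x y := by
    ext e
    simp only [Pi.add_apply]
    ring
  map_smul' c x := by
    ext e
    simp only [Pi.smul_apply, smul_eq_mul, RingHom.id_apply]
    ring

theorem coboundary_edgeOf (x : M.Vertex → ZMod 2) (d : D) :
    M.coboundary x (M.edgeOf d) = x (M.vertexOf d) + x (M.vertexOf (M.rev d)) := by
  have h : M.edgeOf (M.edgeOf d).out = M.edgeOf d := Quotient.out_eq _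
  change x (M.vertexOf (M.edgeOf d).out) + x (M.vertexOf (M.rev (M.edgeOf d).out)) = _
  rcases M.eq_or_eq_rev_of_edgeOf_eq h with h | h
  · rw [← h]
  · generalize (M.edgeOf d).out = t at h ⊢
    rw [h, M.rev_rev, add_comm]

open Classical in
/-- The sum of an edge function over the boundary walk of a face. -/
noncomputable def faceSum [Fintype D] : (M.Edge → ZMod 2) →ₗ[ZMod 2] (M.Face → ZMod 2) where
  toFun s f := ∑ d, if M.faceOf d = f then s (M.edgeOf d) else 0
  map_add' s t := by
    ext f
    simp only [Pi.add_apply, ← Finset.sum_add_distrib]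
    exact Finset.sum_congr rfl fun d _ => by split_ifs <;> simp
  map_smul' c s := by
    ext f
    simp only [Pi.smul_apply, smul_eq_mul, RingHom.id_apply, Finset.mul_sum]
    exact Finset.sum_congr rfl fun d _ => by split_ifs <;> simp

open Classical in
theorem faceSum_apply [Fintype D] (s : M.Edge → ZMod 2) (f : M.Face) :
    M.faceSum s f = ∑ d, if M.faceOf d = f then s (M.edgeOf d) else 0 := rfl

/-- Along a face walk each dart ends where the next one starts, so every start colour is counted
twice; reindexing the sum by `face` makes this visible. -/
theorem faceSum_coboundary [Fintype D] (x : M.Vertex → ZMod 2) :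
    M.faceSum (M.coboundary x) = 0 := by
  classical
  ext f
  rw [faceSum_apply]
  have h1 : ∀ d, (if M.faceOf d = f then M.coboundary x (M.edgeOf d) else 0) =
      (if M.faceOf d = f then x (M.vertexOf d) else 0) +
        (if M.faceOf (M.face d) = f then x (M.vertexOf (M.face d)) else 0) := by
    intro d
    rw [coboundary_edgeOf, faceOf_face, vertexOf_face]
    split_ifs <;> simp
  simp only [h1, Finset.sum_add_distrib]
  rw [Equiv.sum_comp M.face (fun d => if M.faceOf d = f then x (M.vertexOf d) else 0)]
  exact CharTwo.add_self_eq_zero _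

open Classical in
theorem faceSum_single [Fintype D] (d : D) :
    M.faceSum (Pi.single (M.edgeOf d) 1) =
      Pi.single (M.faceOf d) 1 + Pi.single (M.faceOf (M.rev d)) 1 := by
  ext f
  rw [faceSum_apply, ← Finset.sum_subset (Finset.subset_univ {d, M.rev d})]
  · rw [Finset.sum_pair (M.rev_ne d).symm, M.edgeOf_rev]
    simp only [Pi.add_apply, Pi.single_apply, eq_comm]
    simp
  · intro d' _ hd'
    simp only [Finset.mem_insert, Finset.mem_singleton] at hd'
    rw [Pi.single_eq_of_ne, ite_self]
    intro h
    exact hd' (M.eq_or_eq_rev_of_edgeOf_eq h.symm)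

theorem exists_dart_of_adj {v w : M.Vertex} (h : M.graph.Adj v w) :
    ∃ d, M.vertexOf d = v ∧ M.vertexOf (M.rev d) = w := by
  obtain ⟨e, d, -, h1, h2⟩ := h
  exact ⟨d, h1, h2⟩

/-- A relation that is respected by `rot` and `rev` holds everywhere in a connected map. -/
theorem rel_of_isConnected (hM : SignedGraph.IsConnected M.graph) {r : D → D → Prop}
    (hr : Equivalence r) (h1 : ∀ d, r d (M.rot d)) (h2 : ∀ d, r d (M.rev d)) (d d' : D) :
    r d d' := by
  have h3 : ∀ w, Relation.ReflTransGen M.graph.Adj (M.vertexOf d) w →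
      ∀ d', M.vertexOf d' = w → r d d' := by
    intro w hw
    induction hw with
    | refl => exact fun d' hd' => rel_of_sameCycle hr h1 (Quotient.exact hd'.symm)
    | tail _ hab ih =>
      intro d' hd'
      obtain ⟨t, ht1, ht2⟩ := M.exists_dart_of_adj hab
      exact hr.trans (ih t ht1) (hr.trans (h2 t)
        (rel_of_sameCycle hr h1 (Quotient.exact (ht2.trans hd'.symm))))
  exact h3 _ (hM.2 _ (Set.mem_univ _) _ (Set.mem_univ _)) d' rfl

/-- A colouring without changes is constant along walks, so the kernel consists of constants. -/
theorem finrank_ker_coboundary_le (hM : SignedGraph.IsConnected M.graph) [Finite D] :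
    Module.finrank (ZMod 2) (LinearMap.ker M.coboundary) ≤ 1 := by
  obtain ⟨⟨v, hv⟩, hc⟩ := hM
  have h1 : LinearMap.ker M.coboundary ≤ Submodule.span (ZMod 2) {fun _ => 1} := by
    intro x hx
    rw [Submodule.mem_span_singleton]
    refine ⟨x v, ?_⟩
    ext w
    have h2 : ∀ w, Relation.ReflTransGen M.graph.Adj v w → x v = x w := by
      intro w hw
      induction hw with
      | refl => rfl
      | tail _ hab ih =>
        obtain ⟨d, rfl, rfl⟩ := M.exists_dart_of_adj hab
        rw [ih]
        have h3 := congrFun (LinearMap.mem_ker.mp hx) (M.edgeOf d)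
        rw [coboundary_edgeOf] at h3
        exact CharTwo.add_eq_zero.mp h3
    simp [h2 w (hc v hv w (Set.mem_univ _))]
  exact (Submodule.finrank_mono h1).trans (finrank_span_singleton_le _)

/-- The dual of the bound on the kernel of `coboundary`: a single edge has as its face sums the two
faces beside it. Since the map is connected, any two faces differ by an element of the range, so one
further basis vector spans everything. -/
theorem card_face_le (hM : SignedGraph.IsConnected M.graph) [Fintype D] :
    Nat.card M.Face ≤ Module.finrank (ZMod 2) (LinearMap.range M.faceSum) + 1 := by
  classical
  have := Fintype.ofFinite M.Face
  rcases isEmpty_or_nonempty M.Face with h | ⟨⟨f⟩⟩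
  · simp
  obtain ⟨d, rfl⟩ : ∃ d, M.faceOf d = f := Quotient.exists_rep f
  have key : ∀ d', (Pi.single (M.faceOf d) 1 + Pi.single (M.faceOf d') 1 : M.Face → ZMod 2) ∈
      LinearMap.range M.faceSum := by
    intro d'
    refine M.rel_of_isConnected hM (r := fun a b =>
      (Pi.single (M.faceOf a) 1 + Pi.single (M.faceOf b) 1 : M.Face → ZMod 2) ∈
      LinearMap.range M.faceSum) ⟨?_, ?_, ?_⟩ ?_ ?_ d d'
    · intro a
      rw [fun_add_self]
      exact Submodule.zero_mem _
    · intro a b hab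
      rwa [add_comm]
    · intro a b c hab hbc
      have := Submodule.add_mem _ hab hbc
      rwa [add_assoc, ← add_assoc (Pi.single (M.faceOf b) 1), fun_add_self,
        zero_add] at this
    · intro a
      rw [M.faceOf_rot]
      exact ⟨_, M.faceSum_single a⟩
    · intro a
      exact ⟨_, M.faceSum_single a⟩
  have htop : (⊤ : Submodule (ZMod 2) (M.Face → ZMod 2)) ≤
      LinearMap.range M.faceSum ⊔ Submodule.span (ZMod 2) {Pi.single (M.faceOf d) 1} := by
    rw [← Pi.basisFun (ZMod 2) M.Face |>.span_eq, Submodule.span_le]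
    rintro _ ⟨g, rfl⟩
    obtain ⟨d', rfl⟩ : ∃ d', M.faceOf d' = g := Quotient.exists_rep g
    rw [Pi.basisFun_apply]
    have := Submodule.add_mem_sup (key d') (Submodule.mem_span_singleton_self
      (R := ZMod 2) (Pi.single (M.faceOf d) 1 : M.Face → ZMod 2))
    rwa [add_right_comm, fun_add_self, zero_add] at this
  have h1 := Submodule.finrank_mono htop
  rw [finrank_top, Module.finrank_fintype_fun_eq_card, ← Nat.card_eq_fintype_card] at h1
  have h2 := Submodule.finrank_add_le_finrank_add_finrank (LinearMap.range M.faceSum)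
    (Submodule.span (ZMod 2) {(Pi.single (M.faceOf d) 1 : M.Face → ZMod 2)})
  have h3 := finrank_span_singleton_le (Pi.single (M.faceOf d) 1 : M.Face → ZMod 2)
  omega

/-- In a plane map, an edge function with sum zero around every face is a coboundary. -/
theorem exists_coboundary_eq [Fintype D] (hM : M.IsPlane) {s : M.Edge → ZMod 2}
    (hs : M.faceSum s = 0) : ∃ x, M.coboundary x = s := by
  classical
  have := Fintype.ofFinite M.Vertex
  have := Fintype.ofFinite M.Edge
  have h1 := LinearMap.finrank_range_add_finrank_ker M.coboundary
  have h2 := LinearMap.finrank_range_add_finrank_ker M.faceSum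
  rw [Module.finrank_fintype_fun_eq_card, ← Nat.card_eq_fintype_card] at h1 h2
  have h3 := M.finrank_ker_coboundary_le hM.1
  have h4 := M.card_face_le hM.1
  have h5 := hM.2
  have h6 : LinearMap.range M.coboundary ≤ LinearMap.ker M.faceSum := by
    rintro _ ⟨x, rfl⟩
    exact LinearMap.mem_ker.mpr (M.faceSum_coboundary x)
  -- The two rank bounds and Euler's formula give `dim ker faceSum ≤ |E| - |F| + 1 = |V| - 1 ≤ dim
  -- range coboundary`.
  have h7 : LinearMap.range M.coboundary = LinearMap.ker M.faceSum :=
    Submodule.eq_of_le_of_finrank_le h6 (by omega)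
  have h8 : s ∈ LinearMap.range M.coboundary := by rw [h7]; exact LinearMap.mem_ker.mpr hs
  exact h8

end CombMap

/-! ### Faces of 2-connected plane cubic maps -/

namespace CombMap

variable {D : Type*} {M : CombMap D}

theorem IsCubic.rot_rot_rot (hM : M.IsCubic) (d : D) : M.rot (M.rot (M.rot d)) = d := by
  have h := Function.iterate_minimalPeriod (f := M.rot) (x := d)
  rw [hM d] at h
  exact h

theorem IsCubic.rot_ne (hM : M.IsCubic) (d : D) : M.rot d ≠ d := by
  intro h
  have h1 := Function.IsPeriodicPt.minimalPeriod_le (f := M.rot) (x := d) one_pos h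
  rw [hM d] at h1
  omega

theorem IsCubic.eq_of_vertexOf_eq (hM : M.IsCubic) {d d' : D}
    (h : M.vertexOf d' = M.vertexOf d) : d' = d ∨ d' = M.rot d ∨ d' = M.rot (M.rot d) := by
  have hr : Equivalence (fun a b : D => b = a ∨ b = M.rot a ∨ b = M.rot (M.rot a)) := by
    have h3 := hM.rot_rot_rot
    constructor
    · intro a
      exact Or.inl rfl
    · rintro a b (rfl | rfl | rfl) <;> simp [h3]
    · rintro a b c (rfl | rfl | rfl) (rfl | rfl | rfl) <;> simp [h3]
  exact rel_of_sameCycle hr (fun a => Or.inr (Or.inl rfl)) (Quotient.exact h.symm)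

theorem vertexOf_rev_ne (hM : SignedGraph.IsTwoConnected M.graph) (d : D) :
    M.vertexOf (M.rev d) ≠ M.vertexOf d := by
  intro h
  exact hM.2.1 (M.edgeOf d) (M.vertexOf d) ⟨d, rfl, rfl, h⟩

/-- A 2-connected plane cubic map is bridgeless: no edge has the same face on both sides. -/
theorem faceOf_rev_ne [Finite D] (hp : M.IsPlane) (hc : M.IsCubic)
    (h2 : SignedGraph.IsTwoConnected M.graph) (d : D) : M.faceOf (M.rev d) ≠ M.faceOf d := by
  classical
  have := Fintype.ofFinite D
  intro h
  -- With the same face on both sides, the edge of `d` alone is a cut, so its ends get different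
  -- colours. But the tail of `d` has the colour of its neighbour along `t`, and without the tail
  -- the graph is still connected, so that the head of `d` has this colour too.
  obtain ⟨x, hx⟩ := M.exists_coboundary_eq hp (s := Pi.single (M.edgeOf d) 1) (by
    rw [faceSum_single, h, fun_add_self])
  have hx' : ∀ t, x (M.vertexOf t) + x (M.vertexOf (M.rev t)) =
      if M.edgeOf t = M.edgeOf d then 1 else 0 := by
    intro t
    rw [← coboundary_edgeOf, hx, Pi.single_apply]
  have hd := hx' d
  rw [if_pos rfl] at hd
  set t := M.rot d with ht
  have hvt : M.vertexOf t = M.vertexOf d := M.vertexOf_rot d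
  have hne : M.edgeOf t ≠ M.edgeOf d := by
    intro he
    rcases M.eq_or_eq_rev_of_edgeOf_eq he with h1 | h1
    · exact hc.rot_ne d h1.symm
    · exact vertexOf_rev_ne h2 t (by rw [← h1, hvt])
  have h3 := hx' t
  rw [if_neg hne, hvt, CharTwo.add_eq_zero] at h3
  have hcon := h2.2.2 (M.vertexOf d) (Set.mem_univ _)
  have h4 : ∀ w, Relation.ReflTransGen (M.graph.deleteVerts {M.vertexOf d}).Adj
      (M.vertexOf (M.rev t)) w → x w = x (M.vertexOf d) := by
    intro w hw
    induction hw with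
    | refl => exact h3.symm
    | @tail b c _ hbc ih =>
      obtain ⟨e, hl⟩ := hbc
      rw [Graph.deleteVerts_isLink] at hl
      obtain ⟨⟨u, -, rfl, rfl⟩, hb, hc'⟩ := hl
      have h5 := hx' u
      rw [if_neg, CharTwo.add_eq_zero] at h5
      · rw [← h5, ih]
      · intro he
        rcases M.eq_or_eq_rev_of_edgeOf_eq he with h1 | h1
        · exact hb (by rw [h1]; rfl)
        · exact hc' (by rw [h1]; rfl)
  have h5 := h4 (M.vertexOf (M.rev d)) (hcon.2 _ ⟨Set.mem_univ _, ?_⟩ _ ⟨Set.mem_univ _, ?_⟩)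
  · rw [h5, CharTwo.add_self_eq_zero] at hd
    exact zero_ne_one hd
  · intro h6
    exact vertexOf_rev_ne h2 t (by rw [hvt]; exact h6)
  · exact vertexOf_rev_ne h2 d

/-- Each face has at most one corner at each vertex. -/
theorem eq_of_vertexOf_eq_of_faceOf_eq [Finite D] (hp : M.IsPlane) (hc : M.IsCubic)
    (h2 : SignedGraph.IsTwoConnected M.graph) {s t : D} (hv : M.vertexOf s = M.vertexOf t)
    (hf : M.faceOf s = M.faceOf t) : s = t := by
  have hb := faceOf_rev_ne hp hc h2
  rcases hc.eq_of_vertexOf_eq hv with h | h | h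
  · exact h
  · rw [h, faceOf_rot] at hf
    exact absurd hf (hb t)
  · have h3 : t = M.rot s := by rw [h, hc.rot_rot_rot]
    rw [h3, faceOf_rot] at hf
    exact absurd hf.symm (hb s)

/-- In a bridgeless cubic map, consecutive edges of a face have different faces across. -/
theorem faceOf_rev_face_ne [Finite D] (hp : M.IsPlane) (hc : M.IsCubic)
    (h2 : SignedGraph.IsTwoConnected M.graph) (t : D) :
    M.faceOf (M.rev (M.face t)) ≠ M.faceOf (M.rev t) := by
  intro h
  -- Otherwise the third edge at the common vertex has the same face on both sides.
  apply faceOf_rev_ne hp hc h2 (M.rot (M.face t))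
  rw [faceOf_rot, h, ← faceOf_face, face_rev, face_apply, hc.rot_rot_rot]

/-- If the boundaries of two distinct faces meet in a connected graph, they share at most one
edge. -/
theorem eq_of_isConnected_faceInter [Finite D] (hp : M.IsPlane) (hc : M.IsCubic)
    (h2 : SignedGraph.IsTwoConnected M.graph) {s t : D} (hst : M.faceOf s = M.faceOf t)
    (hr : M.faceOf (M.rev s) = M.faceOf (M.rev t))
    (hcon : SignedGraph.IsConnected (M.faceInter (M.faceOf (M.rev t)) (M.faceOf t))) : s = t := by
  have hb := faceOf_rev_ne hp hc h2
  have hu := fun {a b : D} => eq_of_vertexOf_eq_of_faceOf_eq hp hc h2 (s := a) (t := b)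
  have hvr : ∀ a, M.vertexOf (M.rev a) = M.vertexOf (M.face a) :=
    fun a => (M.vertexOf_face a).symm
  -- Two shared edges with a common end coincide, so a walk in the intersection that starts on the
  -- edge of `t` never leaves that edge.
  have hcase : ∀ a, M.faceOf a = M.faceOf t → M.faceOf (M.rev a) = M.faceOf (M.rev t) →
      ∀ v, (v = M.vertexOf a ∨ v = M.vertexOf (M.rev a)) →
      (v = M.vertexOf t ∨ v = M.vertexOf (M.rev t)) → a = t := by
    rintro a ha hra v (rfl | rfl) (hv | hv)
    · exact hu hv ha
    · rw [hvr] at hv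
      have h3 := hu hv (by rw [ha, faceOf_face])
      rw [h3] at hra
      exact absurd hra (faceOf_rev_face_ne hp hc h2 t)
    · rw [hvr] at hv
      have h3 := hu hv (by rw [faceOf_face, ha])
      rw [← h3] at hra
      exact absurd hra.symm (faceOf_rev_face_ne hp hc h2 a)
    · rw [hvr, hvr] at hv
      exact M.face.injective (hu hv (by rw [faceOf_face, faceOf_face, ha]))
  have hreach : ∀ w, Relation.ReflTransGen
      (M.faceInter (M.faceOf (M.rev t)) (M.faceOf t)).Adj (M.vertexOf t) w →
      (w = M.vertexOf t ∨ w = M.vertexOf (M.rev t)) := by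
    intro w hw
    induction hw with
    | refl => exact Or.inl rfl
    | @tail b c _ hbc ih =>
      obtain ⟨e, hl⟩ := hbc
      rw [faceInter, Graph.induce_isLink, Graph.restrict_isLink] at hl
      obtain ⟨⟨⟨⟨a', ha', hae'⟩, ⟨a, ha, hae⟩⟩, u, hue, rfl, rfl⟩, -, -⟩ := hl
      have ha2 : M.faceOf (M.rev a) = M.faceOf (M.rev t) := by
        rcases M.eq_or_eq_rev_of_edgeOf_eq (hae.trans hae'.symm) with h | h
        · rw [h, ha] at ha'
          exact absurd ha'.symm (hb t)
        · rwa [h] at ha'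
      rcases M.eq_or_eq_rev_of_edgeOf_eq (hae.trans hue.symm) with h | h
      · have := hcase a ha ha2 (M.vertexOf u) (Or.inl (by rw [h])) ih
        subst this
        rw [h]
        exact Or.inr rfl
      · have := hcase a ha ha2 (M.vertexOf u) (Or.inr (by rw [h])) ih
        subst this
        rw [h, M.rev_rev]
        exact Or.inl rfl
  have hmem : ∀ a, M.faceOf a = M.faceOf t → M.faceOf (M.rev a) = M.faceOf (M.rev t) →
      M.vertexOf a ∈ V(M.faceInter (M.faceOf (M.rev t)) (M.faceOf t)) := by
    intro a ha hra
    exact ⟨⟨M.face (M.rev a), by rw [faceOf_face, hra], by rw [vertexOf_face, M.rev_rev]⟩,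
      ⟨a, ha, rfl⟩⟩
  exact hcase s hst hr _ (Or.inl rfl)
    (hreach _ (hcon.2 _ (hmem t rfl rfl) _ (hmem s hst hr)))

end CombMap

/-- The form in which normality is used: a boundary face has exactly one edge on `C'`, because a
connected intersection of two face boundaries has at most one edge. -/
theorem CanonicalEmbedding.IsNormal.eq_of_faceOf_rev_eq {α β : Type*} {G : Graph α β}
    {σ : β → ℤˣ} {k : ℕ} {D : Type*} [Finite D] {Φ : CanonicalEmbedding G σ k D}
    (hΦ : Φ.IsNormal) {s t : D} (hs : Φ.map.faceOf s = Φ.outerFace)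
    (ht : Φ.map.faceOf t = Φ.outerFace)
    (hst : Φ.map.faceOf (Φ.map.rev s) = Φ.map.faceOf (Φ.map.rev t)) : s = t := by
  refine CombMap.eq_of_isConnected_faceInter Φ.isPlane Φ.isCubic Φ.isTwoConnected
    (hs.trans ht.symm) hst ?_
  by_contra hcon
  refine hΦ (Φ.map.faceOf (Φ.map.rev t)) ⟨⟨?_, Φ.map.edgeOf t, ?_, ?_⟩, ?_⟩
  · rw [← ht]
    exact CombMap.faceOf_rev_ne Φ.isPlane Φ.isCubic Φ.isTwoConnected t
  · exact ⟨Φ.map.rev t, rfl, Φ.map.edgeOf_rev t⟩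
  · exact ⟨t, ht, rfl⟩
  · rwa [← ht]

/-! ### A cycle subdivided by inserted points

The edges of a cycle are numbered by `Fin m`, and point `a` is inserted on the edge `pos a`. The
corner at which edge `j` starts has number `j`; the corner number `m` closes the cycle. Segments are
named after the corner or the point at which they start. -/

namespace SubdividedCycle

variable {m n : ℕ} (pos : Fin n → Fin m)

/-- The number of the edge that contains a segment. -/
def edgeIdx : Fin m ⊕ Fin n → ℕ
  | .inl j => j
  | .inr a => pos a

/-- The number of points that come before a segment. -/
noncomputable def numBefore : Fin m ⊕ Fin n → ℕ
  | .inl j => sInf {c | ∀ a : Fin n, c ≤ a → j ≤ pos a}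
  | .inr a => a + 1

/-- The value of a colouring of corners and points at the start of a segment. -/
def startVal (g : ℕ → ZMod 2) (y : Fin n → ZMod 2) : Fin m ⊕ Fin n → ZMod 2
  | .inl j => g j
  | .inr a => y a

open Classical in
/-- The value of a colouring of corners and points at the end of a segment. -/
noncomputable def endVal (g : ℕ → ZMod 2) (y : Fin n → ZMod 2) (s : Fin m ⊕ Fin n) : ZMod 2 :=
  if h : ∃ h : numBefore pos s < n, (pos ⟨numBefore pos s, h⟩ : ℕ) = edgeIdx pos s then
    y ⟨numBefore pos s, h.1⟩ else g (edgeIdx pos s + 1)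

/-- The change of a colouring of corners and points along a segment. -/
noncomputable def change (g : ℕ → ZMod 2) (y : Fin n → ZMod 2) (s : Fin m ⊕ Fin n) : ZMod 2 :=
  startVal g y s + endVal pos g y s

/-- The corners after a segment. -/
def cornerAfter (s : Fin m ⊕ Fin n) (j : ℕ) : ZMod 2 := if edgeIdx pos s < j then 1 else 0

open Classical in
/-- The points after a segment. -/
noncomputable def pointAfter (s : Fin m ⊕ Fin n) (a : Fin n) : ZMod 2 :=
  if numBefore pos s ≤ a then 1 else 0

variable {pos}

theorem numBefore_inl_le_iff (hpos : Monotone pos) {j : Fin m} {a : Fin n} :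
    numBefore pos (.inl j) ≤ a ↔ j ≤ pos a := by
  -- The number `n` satisfies the condition vacuously, so the infimum in `numBefore` is attained.
  have hne : {c : ℕ | ∀ a : Fin n, c ≤ a → j ≤ pos a}.Nonempty :=
    ⟨n, fun a h => absurd a.2 (by omega)⟩
  refine ⟨fun h => Nat.sInf_mem hne a h, fun h => Nat.sInf_le ?_⟩
  exact fun b hb => h.trans (hpos hb)

theorem numBefore_inl_le (j : Fin m) : numBefore pos (.inl j) ≤ n :=
  Nat.sInf_le fun a h => absurd a.2 (by omega)

theorem numBefore_le (s : Fin m ⊕ Fin n) : numBefore pos s ≤ n := by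
  rcases s with j | a
  · exact numBefore_inl_le j
  · exact a.2

theorem edgeIdx_lt (s : Fin m ⊕ Fin n) : edgeIdx pos s < m := by
  rcases s with j | a
  · exact j.2
  · exact (pos a).2

theorem pos_le_of_lt (hpos : Monotone pos) {s : Fin m ⊕ Fin n} {a : Fin n}
    (h : (a : ℕ) < numBefore pos s) : (pos a : ℕ) ≤ edgeIdx pos s := by
  rcases s with j | b
  · have := mt (numBefore_inl_le_iff hpos).mpr (not_le.mpr h)
    exact (not_le.mp this).le
  · exact hpos (show a ≤ b from Nat.lt_succ_iff.mp h)

theorem le_pos_of_le (hpos : Monotone pos) {s : Fin m ⊕ Fin n} {a : Fin n}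
    (h : numBefore pos s ≤ a) : edgeIdx pos s ≤ (pos a : ℕ) := by
  rcases s with j | b
  · exact (numBefore_inl_le_iff hpos).mp h
  · exact hpos (show b ≤ a from (Nat.le_succ _).trans h)

theorem numBefore_mono (hpos : Monotone pos) {s t : Fin m ⊕ Fin n}
    (h : edgeIdx pos s < edgeIdx pos t) : numBefore pos s ≤ numBefore pos t := by
  by_contra! hlt
  have h1 := pos_le_of_lt hpos (s := s) (a := ⟨_, hlt.trans_le (numBefore_le s)⟩) hlt
  have h2 := le_pos_of_le hpos (s := t) (a := ⟨_, hlt.trans_le (numBefore_le s)⟩) le_rfl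
  omega

/-- The indicator colouring of everything after the segment `s` changes exactly along `s`. -/
theorem change_after (hpos : Monotone pos) (s r : Fin m ⊕ Fin n) :
    change pos (cornerAfter pos s) (pointAfter pos s) r = if r = s then 1 else 0 := by
  classical
  have hlt := fun {s} {a} => pos_le_of_lt hpos (s := s) (a := a)
  have hle := fun {s} {a} => le_pos_of_le hpos (s := s) (a := a)
  -- The order of the segments along the cycle is the lexicographic order of the pairs (`edgeIdx`,
  -- `numBefore`), and this pair determines the segment. The start of `r` lies after `s` when `r` is
  -- strictly larger than `s`, the end already when it is at least `s`; so the two colours differ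
  -- only for `r = s`.
  have hinj : edgeIdx pos s = edgeIdx pos r → numBefore pos s = numBefore pos r → r = s := by
    intro h1 h2
    rcases s with i | a <;> rcases r with j | b
    · rw [Fin.ext (show (i : ℕ) = j from h1)]
    · have h3 := mt (numBefore_inl_le_iff hpos (j := i) (a := b)).mpr (by rw [h2]; simp [numBefore])
      exact absurd (Fin.le_def.mpr (show (i : ℕ) ≤ pos b from h1.le)) h3
    · have h3 := mt (numBefore_inl_le_iff hpos (j := j) (a := a)).mpr
        (by rw [← h2]; simp [numBefore])
      exact absurd (Fin.le_def.mpr (show (j : ℕ) ≤ pos a from h1.symm.le)) h3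
    · rw [Fin.ext (show (a : ℕ) = b by simpa [numBefore] using h2)]
  have hstart : startVal (cornerAfter pos s) (pointAfter pos s) r =
      if edgeIdx pos s < edgeIdx pos r ∨
        (edgeIdx pos s = edgeIdx pos r ∧ numBefore pos s < numBefore pos r) then 1 else 0 := by
    rcases r with j | b
    · simp only [startVal, cornerAfter]
      refine if_congr ?_ rfl rfl
      refine ⟨Or.inl, ?_⟩
      rintro (h | ⟨h1, h2⟩)
      · exact h
      · exfalso
        have h3 : numBefore pos s < n := h2.trans_le (numBefore_le _)
        have h4 := mt (numBefore_inl_le_iff hpos (j := j) (a := ⟨_, h3⟩)).mpr (not_le.mpr h2)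
        have h5 := hle (s := s) (a := ⟨_, h3⟩) le_rfl
        rw [h1] at h5
        exact h4 h5
    · simp only [startVal, pointAfter]
      refine if_congr ?_ rfl rfl
      have h1 := @hlt s b
      have h2 := @hle s b
      have h3 : numBefore pos (.inr b) = b + 1 := rfl
      have h4 : edgeIdx pos (.inr b) = pos b := rfl
      rw [h3, h4]
      omega
  have hend : endVal pos (cornerAfter pos s) (pointAfter pos s) r =
      if edgeIdx pos s < edgeIdx pos r ∨
        (edgeIdx pos s = edgeIdx pos r ∧ numBefore pos s ≤ numBefore pos r) then 1 else 0 := by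
    by_cases h : ∃ h : numBefore pos r < n, (pos ⟨numBefore pos r, h⟩ : ℕ) = edgeIdx pos r
    · rw [endVal, dif_pos h]
      simp only [pointAfter]
      refine if_congr ?_ rfl rfl
      obtain ⟨h0, h⟩ := h
      have h1 := @hlt s ⟨_, h0⟩
      have h2 := @hle s ⟨_, h0⟩
      simp only at h1 h2
      omega
    · rw [endVal, dif_neg h]
      simp only [cornerAfter]
      refine if_congr ?_ rfl rfl
      by_cases h0 : numBefore pos r < numBefore pos s
      · have h3 := h0.trans_le (numBefore_le s)
        have h1 := @hlt s ⟨_, h3⟩ h0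
        have h2 := @hle r ⟨_, h3⟩ le_rfl
        have h4 : ((pos ⟨_, h3⟩ : Fin m) : ℕ) ≠ edgeIdx pos r := fun h' => h ⟨h3, h'⟩
        omega
      · omega
  rw [change, hstart, hend]
  by_cases h : r = s
  · subst h
    simp
  · have h1 : ¬ (edgeIdx pos s = edgeIdx pos r ∧ numBefore pos s = numBefore pos r) :=
      fun h2 => h (hinj h2.1 h2.2)
    rw [if_neg h]
    have h2 : (edgeIdx pos s < edgeIdx pos r ∨
        (edgeIdx pos s = edgeIdx pos r ∧ numBefore pos s < numBefore pos r)) ↔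
        (edgeIdx pos s < edgeIdx pos r ∨
        (edgeIdx pos s = edgeIdx pos r ∧ numBefore pos s ≤ numBefore pos r)) := by omega
    rw [if_congr h2 rfl rfl]
    exact CharTwo.add_self_eq_zero _

/-- A colouring without changes is constant. -/
theorem eq_of_change_eq_zero {g : ℕ → ZMod 2} {y : Fin n → ZMod 2}
    (h : ∀ s, change pos g y s = 0) : (∀ j ≤ m, g j = g 0) ∧ ∀ a, y a = g 0 := by
  have h' : ∀ s, startVal g y s = endVal pos g y s := fun s => CharTwo.add_eq_zero.mp (h s)
  -- Induction from the last point backwards: the colour is carried to the corner that ends the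
  -- edge.
  have h1 : ∀ t (a : Fin n), n - a = t → y a = g (pos a + 1) := by
    intro t
    induction t with
    | zero => intro a ha; have := a.2; omega
    | succ t ih =>
      intro a ha
      have h2 : y a = endVal pos g y (.inr a) := h' (.inr a)
      rw [h2]
      unfold endVal
      split_ifs with h3
      · rw [ih _ (by change n - (a + 1) = t; omega), h3.2]
        rfl
      · rfl
  have h2 : ∀ j : Fin m, g j = g (j + 1) := by
    intro j
    have h3 : g j = endVal pos g y (.inl j) := h' (.inl j)
    rw [h3]
    unfold endVal
    split_ifs with h3
    · rw [h1 _ _ rfl, h3.2]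
      rfl
    · rfl
  have h3 : ∀ j ≤ m, g j = g 0 := by
    intro j
    induction j with
    | zero => exact fun _ => rfl
    | succ j ih =>
      intro hj
      rw [← ih (by omega)]
      exact (h2 ⟨j, hj⟩).symm
  exact ⟨h3, fun a => by rw [h1 _ a rfl, h3 _ (pos a).2]⟩

theorem change_add_sum {ι : Type*} (u : Finset ι) (c : ι → ZMod 2) (g : ℕ → ZMod 2)
    (y : Fin n → ZMod 2) (g' : ι → ℕ → ZMod 2) (y' : ι → Fin n → ZMod 2) (s : Fin m ⊕ Fin n) :
    change pos (fun j => g j + ∑ i ∈ u, c i * g' i j) (fun a => y a + ∑ i ∈ u, c i * y' i a) s =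
      change pos g y s + ∑ i ∈ u, c i * change pos (g' i) (y' i) s := by
  have h1 : startVal (fun j => g j + ∑ i ∈ u, c i * g' i j)
      (fun a => y a + ∑ i ∈ u, c i * y' i a) s =
      startVal g y s + ∑ i ∈ u, c i * startVal (g' i) (y' i) s := by
    rcases s with j | a <;> rfl
  have h2 : endVal pos (fun j => g j + ∑ i ∈ u, c i * g' i j)
      (fun a => y a + ∑ i ∈ u, c i * y' i a) s =
      endVal pos g y s + ∑ i ∈ u, c i * endVal pos (g' i) (y' i) s := by
    unfold endVal
    split_ifs <;> rfl
  simp only [change, h1, h2, mul_add, Finset.sum_add_distrib]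
  ring

/-- A colouring of the corners and points is determined by its changes. -/
theorem eq_add_sum_change (hpos : Monotone pos) (g : ℕ → ZMod 2) (y : Fin n → ZMod 2) :
    (∀ j ≤ m, g j = g 0 + ∑ s, change pos g y s * cornerAfter pos s j) ∧
      ∀ a, y a = g 0 + ∑ s, change pos g y s * pointAfter pos s a := by
  classical
  -- Adding the step functions of all changing segments cancels every change, so the sum is
  -- constant.
  have h := eq_of_change_eq_zero
    (g := fun j => g j + ∑ s, change pos g y s * cornerAfter pos s j)
    (y := fun a => y a + ∑ s, change pos g y s * pointAfter pos s a) (fun r => by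
      rw [change_add_sum]
      rw [Finset.sum_congr rfl fun s _ => congrArg _ (change_after hpos s r)]
      simp only [mul_ite, mul_one, mul_zero, Finset.sum_ite_eq, Finset.mem_univ, if_true]
      exact CharTwo.add_self_eq_zero _)
  have h0 : ∀ s, cornerAfter pos s 0 = 0 := fun s => by simp [cornerAfter]
  simp only [h0, mul_zero, Finset.sum_const_zero, add_zero] at h
  refine ⟨fun j hj => ?_, fun a => ?_⟩
  · rw [← h.1 j hj, add_assoc, CharTwo.add_self_eq_zero, add_zero]
  · rw [← h.2 a, add_assoc, CharTwo.add_self_eq_zero, add_zero]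

end SubdividedCycle

/-! ### Edge cuts of critically frustrated signed graphs -/

namespace SignedGraph

variable {α β : Type*} {G : Graph α β} {σ π : β → ℤˣ} {k : ℕ}

theorem mem_edgeCut_iff {X : Set α} {e : β} {u v : α} (h : G.IsLink e u v) :
    e ∈ edgeCut G X ↔ ¬ (u ∈ X ↔ v ∈ X) := by
  constructor
  · rintro ⟨x, hx, y, hy, hxy⟩
    rcases G.eq_or_eq_of_isLink_of_isLink h hxy with rfl | rfl
    · rcases h.eq_and_eq_or_eq_and_eq hxy with ⟨-, rfl⟩ | ⟨rfl, rfl⟩ <;> tauto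
    · rcases h.eq_and_eq_or_eq_and_eq hxy with ⟨rfl, rfl⟩ | ⟨-, rfl⟩ <;> tauto
  · intro hX
    by_cases hu : u ∈ X
    · exact ⟨u, hu, v, by tauto, h⟩
    · exact ⟨v, by tauto, u, hu, h.symm⟩

theorem edgeCut_subset (X : Set α) : edgeCut G X ⊆ E(G) := by
  rintro e ⟨x, -, y, -, h⟩
  exact h.edge_mem

theorem mem_edgeCut_symmDiff_iff {X Y : Set α} {e : β} (he : e ∈ E(G)) :
    e ∈ edgeCut G (symmDiff X Y) ↔ ¬ (e ∈ edgeCut G X ↔ e ∈ edgeCut G Y) := by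
  obtain ⟨u, v, h⟩ := Graph.exists_isLink_of_mem_edgeSet he
  simp only [mem_edgeCut_iff h, Set.mem_symmDiff]
  tauto

theorem mem_edgeCut_deleteEdges_iff {X : Set α} {e f : β} (hf : f ≠ e) :
    f ∈ edgeCut (G.deleteEdges {e}) X ↔ f ∈ edgeCut G X := by
  simp [edgeCut, Graph.deleteEdges_isLink, hf]

theorem frustrationIndex_le {τ : β → ℤˣ} (h : SwitchingEquiv G σ τ) :
    frustrationIndex G σ ≤ (negEdges G τ).ncard :=
  Nat.sInf_le ⟨τ, h, rfl⟩

theorem exists_ncard_negEdges_eq (G : Graph α β) (σ : β → ℤˣ) :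
    ∃ τ, SwitchingEquiv G σ τ ∧ (negEdges G τ).ncard = frustrationIndex G σ := by
  refine Nat.sInf_mem (s := {n | ∃ τ, SwitchingEquiv G σ τ ∧ (negEdges G τ).ncard = n})
    ⟨_, σ, ⟨∅, fun e _ => ⟨?_, fun _ => rfl⟩⟩, rfl⟩
  rintro ⟨x, hx, -⟩
  exact absurd hx (Set.notMem_empty x)

/-- Switching at `X` replaces the set of negative edges by its symmetric difference with the cut. -/
theorem negEdges_eq_symmDiff {τ : β → ℤˣ} {X : Set α}
    (h : ∀ e ∈ E(G), (e ∈ edgeCut G X → τ e = -π e) ∧ (e ∉ edgeCut G X → τ e = π e)) :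
    negEdges G τ = symmDiff (negEdges G π) (edgeCut G X) := by
  ext e
  simp only [negEdges, Set.mem_symmDiff, Set.mem_ofPred_eq]
  by_cases he : e ∈ E(G)
  · have h1 := h e he
    by_cases hX : e ∈ edgeCut G X
    · rw [h1.1 hX]
      rcases Int.units_eq_one_or (π e) with h2 | h2 <;> simp [h2, he, hX]
    · rw [h1.2 hX]
      simp [he, hX]
  · have h1 : e ∉ edgeCut G X := fun h => he (edgeCut_subset X h)
    simp [he, h1]

theorem switchingEquiv_of_cut {τ : β → ℤˣ} {X : Set α} (hπ : SwitchingEquiv G σ π)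
    (h : ∀ e ∈ E(G), (e ∈ edgeCut G X → τ e = -π e) ∧ (e ∉ edgeCut G X → τ e = π e)) :
    SwitchingEquiv G σ τ := by
  obtain ⟨Y, hY⟩ := hπ
  refine ⟨symmDiff Y X, fun e he => ?_⟩
  rw [mem_edgeCut_symmDiff_iff he]
  have h1 := h e he
  have h2 := hY e he
  by_cases ha : e ∈ edgeCut G X <;> by_cases hb : e ∈ edgeCut G Y <;> simp_all

theorem ncard_symmDiff {s t : Set β} (hs : s.Finite) (ht : t.Finite) :
    (symmDiff s t).ncard = (s \ t).ncard + (t \ s).ncard :=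
  Set.ncard_union_eq (disjoint_sdiff_sdiff) hs.sdiff ht.sdiff

theorem le_ncard_symmDiff (hcrit : IsCritical k G σ) (hπ : SwitchingEquiv G σ π) (X : Set α) :
    k ≤ (symmDiff (negEdges G π) (edgeCut G X)).ncard := by
  classical
  have h : ∀ e ∈ E(G), (e ∈ edgeCut G X → (if e ∈ edgeCut G X then -π e else π e) = -π e) ∧
      (e ∉ edgeCut G X → (if e ∈ edgeCut G X then -π e else π e) = π e) :=
    fun e _ => ⟨fun h => if_pos h, fun h => if_neg h⟩
  rw [← hcrit.1, ← negEdges_eq_symmDiff h]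
  exact frustrationIndex_le (switchingEquiv_of_cut hπ h)

/-- If `π` has the minimum number of negative edges, then at most half of the edges of each cut are
negative. -/
theorem ncard_neg_le_ncard_pos (hE : E(G).Finite) (hcrit : IsCritical k G σ)
    (hπ : SwitchingEquiv G σ π) (hk : (negEdges G π).ncard = k) (X : Set α) :
    (edgeCut G X ∩ negEdges G π).ncard ≤ (edgeCut G X \ negEdges G π).ncard := by
  have hN : (negEdges G π).Finite := hE.subset fun e he => he.1
  have hC : (edgeCut G X).Finite := hE.subset (edgeCut_subset X)
  have h1 := le_ncard_symmDiff hcrit hπ X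
  rw [ncard_symmDiff hN hC] at h1
  have h2 := Set.ncard_inter_add_ncard_sdiff_eq_ncard (negEdges G π) (edgeCut G X) hN
  rw [Set.inter_comm] at h2
  omega

/-- If `π` has the minimum number of negative edges, then each positive edge of a critical signed
graph is in an equilibrated cut. -/
theorem exists_equilibrated_cut (hE : E(G).Finite) (hcrit : IsCritical k G σ)
    (hπ : SwitchingEquiv G σ π) (hk : (negEdges G π).ncard = k) {e : β} (he : e ∈ E(G))
    (hneg : e ∉ negEdges G π) : ∃ X, e ∈ edgeCut G X ∧
      (edgeCut G X ∩ negEdges G π).ncard = (edgeCut G X \ negEdges G π).ncard := by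
  obtain ⟨τ, ⟨Y, hY⟩, hτ⟩ := exists_ncard_negEdges_eq (G.deleteEdges {e}) σ
  have hcrit2 := hcrit.2 e he
  rw [← hτ] at hcrit2
  obtain ⟨Z, hZ⟩ := hπ
  -- Here `π` is `σ` switched at `Z`, and `τ`, optimal after deleting `e`, is `σ` switched at `Y`;
  -- the two differ by switching at `symmDiff Z Y`.
  refine ⟨symmDiff Z Y, ?_⟩
  have hN : (negEdges G π).Finite := hE.subset fun e he => he.1
  have hC : (edgeCut G (symmDiff Z Y)).Finite := hE.subset (edgeCut_subset _)
  have h1 := le_ncard_symmDiff hcrit ⟨Z, hZ⟩ (symmDiff Z Y)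
  have h2 : negEdges (G.deleteEdges {e}) τ =
      symmDiff (negEdges G π) (edgeCut G (symmDiff Z Y)) \ {e} := by
    ext f
    by_cases hfe : f = e
    · subst hfe
      simp [negEdges]
    by_cases hf : f ∈ E(G)
    · have hf' : f ∈ E(G.deleteEdges {e}) := by simp [hf, hfe]
      have ha := hY f hf'
      have hb := hZ f hf
      rw [mem_edgeCut_deleteEdges_iff hfe] at ha
      simp only [Set.mem_sdiff, Set.mem_symmDiff, mem_edgeCut_symmDiff_iff hf]
      simp only [negEdges, Set.mem_ofPred_eq, hf, hf', true_and, Set.mem_singleton_iff, hfe,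
        not_false_eq_true, and_true]
      by_cases hc : f ∈ edgeCut G Y <;> by_cases hd : f ∈ edgeCut G Z <;>
        rcases Int.units_eq_one_or (σ f) with h2 | h2 <;> simp_all
    · have hc : f ∉ edgeCut G (symmDiff Z Y) := fun h => hf (edgeCut_subset _ h)
      simp [negEdges, hf, hc, Set.mem_symmDiff]
  rw [h2] at hcrit2
  -- After this switching there are at least `k` negative edges, but only `k - 1` apart from `e`. So
  -- `e` became negative, hence lies in the cut, and the total is exactly `k`, which says that the
  -- cut is equilibrated.
  by_cases hmem : e ∈ symmDiff (negEdges G π) (edgeCut G (symmDiff Z Y))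
  · have h3 := Set.ncard_sdiff_singleton_add_one hmem (hN.symmDiff hC)
    rw [h3, ncard_symmDiff hN hC] at hcrit2
    have h4 := Set.ncard_inter_add_ncard_sdiff_eq_ncard (negEdges G π) (edgeCut G (symmDiff Z Y)) hN
    rw [Set.inter_comm] at h4
    refine ⟨?_, by omega⟩
    rcases hmem with h | h
    · exact absurd h.1 hneg
    · exact h.1
  · rw [Set.sdiff_singleton_eq_self hmem] at hcrit2
    omega

end SignedGraph

/-! ### Cuts of a canonical embedding -/

namespace CombMap

variable {D : Type*} (M : CombMap D)

/-- The edges outside the boundary of `f` along which a vertex colouring changes. -/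
def innerChanges (f : M.Face) (x : M.Vertex → ZMod 2) : Set M.Edge :=
  {e | e ∉ M.faceEdges f ∧ M.coboundary x e ≠ 0}

end CombMap

namespace CanonicalData

variable {k : ℕ} {D : Type*} (Φ : CanonicalData k D)

/-- The segments into which `C'` is subdivided. -/
abbrev Seg : Type _ := Fin (Function.minimalPeriod Φ.map.face Φ.root) ⊕ Fin (2 * k)

/-- The change along a segment of a colouring of the vertices of `G'` and the inserted vertices. -/
noncomputable def segChange (x : Φ.map.Vertex → ZMod 2) (y : Fin (2 * k) → ZMod 2) (s : Φ.Seg) :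
    ZMod 2 :=
  SubdividedCycle.change Φ.pos (fun j => x (Φ.corner j)) y s

/-- The change of a colouring along an edge of the constructed signed graph. -/
noncomputable def edgChange (x : Φ.map.Vertex → ZMod 2) (y : Fin (2 * k) → ZMod 2) :
    Φ.Edg → ZMod 2
  | .inner e _ => Φ.map.coboundary x e
  | .fromCorner i => Φ.segChange x y (.inl i)
  | .fromPoint a => Φ.segChange x y (.inr a)
  | .cross a => y ⟨a, by omega⟩ + y ⟨a + k, by omega⟩

variable {Φ}

open SubdividedCycle in
-- This matches the explicit incidences with the arithmetic of segments: the point that may end a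
-- segment is the one with index `numBefore`, and it does so exactly when it lies on the same edge
-- of `C'`.
theorem edgChange_eq (x : Φ.map.Vertex → ZMod 2) (y : Fin (2 * k) → ZMod 2) {e : Φ.Edg}
    {u v : Φ.Vtx} (h : Φ.Link e u v) :
    Φ.edgChange x y e = Sum.elim x y u + Sum.elim x y v := by
  cases h with
  | inner d hd => exact Φ.map.coboundary_edgeOf x d
  | corner_corner i hi =>
    simp only [edgChange, segChange, change, Sum.elim_inl]
    congr 1
    rw [endVal, dif_neg]
    · rfl
    · rintro ⟨h1, h2⟩
      exact hi _ (Fin.ext h2)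
  | corner_point a ha =>
    have hn : numBefore Φ.pos (.inl (Φ.pos a)) = a := by
      refine le_antisymm ((numBefore_inl_le_iff Φ.pos_mono).mpr le_rfl) ?_
      by_contra! hlt
      have h1 := (numBefore_inl_le_iff Φ.pos_mono
        (a := ⟨_, hlt.trans a.2⟩) (j := Φ.pos a)).mp le_rfl
      refine ha ⟨_, hlt.trans a.2⟩ hlt (le_antisymm (Φ.pos_mono ?_) h1)
      exact hlt.le
    simp only [edgChange, segChange, change, Sum.elim_inl, Sum.elim_inr]
    congr 1
    have h1 : (⟨numBefore Φ.pos (.inl (Φ.pos a)), by omega⟩ : Fin (2 * k)) = a := Fin.ext hn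
    rw [endVal, dif_pos ⟨by omega, by rw [h1]; rfl⟩, h1]
  | point_point a b hab hpos =>
    simp only [edgChange, segChange, change, Sum.elim_inr]
    congr 1
    have h1 : (⟨numBefore Φ.pos (.inr a), by change (a : ℕ) + 1 < 2 * k; omega⟩ :
      Fin (2 * k)) = b := Fin.ext hab.symm
    rw [endVal, dif_pos ⟨by change (a : ℕ) + 1 < 2 * k; omega, by rw [h1, ← hpos]; rfl⟩, h1]
  | point_corner a ha =>
    simp only [edgChange, segChange, change, Sum.elim_inr, Sum.elim_inl]
    congr 1
    rw [endVal, dif_neg]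
    · rfl
    · rintro ⟨h1, h2⟩
      exact ha _ (show (a : ℕ) < a + 1 by omega) (Fin.ext h2)
  | cross a => rfl

variable (Φ)

/-- The pairs of opposite inserted vertices that a colouring separates. -/
def crossChanges (y : Fin (2 * k) → ZMod 2) : Set (Fin k) :=
  {a | y ⟨a, by omega⟩ + y ⟨a + k, by omega⟩ ≠ 0}

/-- The segments of `C'` along which a colouring changes. -/
def segChanges (x : Φ.map.Vertex → ZMod 2) (y : Fin (2 * k) → ZMod 2) : Set Φ.Seg :=
  {s | Φ.segChange x y s ≠ 0}

/-- The kinds of edges of the constructed signed graph. -/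
def edgKind : Φ.Edg → (Φ.map.Edge ⊕ Φ.Seg) ⊕ Fin k
  | .inner e _ => .inl (.inl e)
  | .fromCorner i => .inl (.inr (.inl i))
  | .fromPoint a => .inl (.inr (.inr a))
  | .cross a => .inr a

theorem edgKind_injective : Function.Injective Φ.edgKind := by
  rintro (_ | _ | _ | _) (_ | _ | _ | _) h <;> simp_all [edgKind]

theorem ncard_cross_eq (y : Fin (2 * k) → ZMod 2) (x : Φ.map.Vertex → ZMod 2) :
    {e | Φ.edgChange x y e ≠ 0 ∧ Φ.sign e = -1}.ncard = (crossChanges y).ncard := by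
  rw [← Set.ncard_image_of_injective _ Φ.edgKind_injective,
    ← Set.ncard_image_of_injective (crossChanges y) (Sum.inr_injective (α := Φ.map.Edge ⊕ Φ.Seg))]
  congr 1
  ext t
  constructor
  · rintro ⟨(_ | _ | _ | a), ⟨h1, h2⟩, rfl⟩
    · exact absurd h2 (by simp [sign])
    · exact absurd h2 (by simp [sign])
    · exact absurd h2 (by simp [sign])
    · exact ⟨a, h1, rfl⟩
  · rintro ⟨a, h, rfl⟩
    exact ⟨.cross a, ⟨h, rfl⟩, rfl⟩

theorem ncard_pos_eq [Finite D] (x : Φ.map.Vertex → ZMod 2) (y : Fin (2 * k) → ZMod 2) :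
    {e | Φ.edgChange x y e ≠ 0 ∧ ¬ Φ.sign e = -1}.ncard =
      (Φ.map.innerChanges Φ.outerFace x).ncard + (Φ.segChanges x y).ncard := by
  rw [← Set.ncard_image_of_injective _ Φ.edgKind_injective,
    ← Set.ncard_image_of_injective (Φ.map.innerChanges Φ.outerFace x)
      (Sum.inl_injective (β := Φ.Seg)),
    ← Set.ncard_image_of_injective (Φ.segChanges x y) (Sum.inr_injective (α := Φ.map.Edge)),
    ← Set.ncard_union_eq, ← Set.ncard_image_of_injective
      (Sum.inl '' Φ.map.innerChanges Φ.outerFace x ∪ Sum.inr '' Φ.segChanges x y)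
      (Sum.inl_injective (β := Fin k))]
  · congr 1
    ext t
    constructor
    · rintro ⟨(⟨e, he⟩ | i | i | a), ⟨h1, h2⟩, rfl⟩
      · exact ⟨_, Or.inl ⟨e, ⟨he, h1⟩, rfl⟩, rfl⟩
      · exact ⟨_, Or.inr ⟨.inl i, h1, rfl⟩, rfl⟩
      · exact ⟨_, Or.inr ⟨.inr i, h1, rfl⟩, rfl⟩
      · exact absurd rfl h2
    · rintro ⟨_, ⟨e, ⟨he, h1⟩, rfl⟩ | ⟨(i | i), h1, rfl⟩, rfl⟩
      · exact ⟨.inner e he, ⟨h1, by simp [sign]⟩, rfl⟩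
      · exact ⟨.fromCorner i, ⟨h1, by simp [sign]⟩, rfl⟩
      · exact ⟨.fromPoint i, ⟨h1, by simp [sign]⟩, rfl⟩
  · rw [Set.disjoint_left]
    rintro _ ⟨e, -, rfl⟩ ⟨s, -, h⟩
    exact absurd h (by simp)

end CanonicalData

namespace CanonicalEmbedding

variable {α β D : Type*} {G : Graph α β} {σ π : β → ℤˣ} {k : ℕ} (Φ : CanonicalEmbedding G π k D)

/-- The edge of `G` with a given name in the construction. -/
def edge (e : Φ.Edg) : β := Φ.edgeEquiv e

theorem edge_injective : Function.Injective Φ.edge :=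
  Subtype.val_injective.comp Φ.edgeEquiv.injective

theorem exists_edge_eq {f : β} (hf : f ∈ E(G)) : ∃ e, Φ.edge e = f :=
  ⟨Φ.edgeEquiv.symm ⟨f, hf⟩, by simp [edge]⟩

theorem edge_mem (e : Φ.Edg) : Φ.edge e ∈ E(G) := (Φ.edgeEquiv e).2

theorem exists_link (e : Φ.Edg) : ∃ u v, Φ.Link e u v ∧
    G.IsLink (Φ.edge e) (Φ.vertexEquiv u) (Φ.vertexEquiv v) := by
  obtain ⟨a, b, hab⟩ := Graph.exists_isLink_of_mem_edgeSet (Φ.edge_mem e)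
  obtain ⟨u, hu⟩ := Φ.vertexEquiv.surjective ⟨a, hab.left_mem⟩
  obtain ⟨v, hv⟩ := Φ.vertexEquiv.surjective ⟨b, hab.right_mem⟩
  have h : G.IsLink (Φ.edge e) (Φ.vertexEquiv u) (Φ.vertexEquiv v) := by rwa [hu, hv]
  rcases (Φ.isLink_iff e u v).mp h with h1 | h1
  · exact ⟨u, v, h1, h⟩
  · exact ⟨v, u, h1, h.symm⟩

/-- The vertices of `G` that get colour `1`. -/
def colourClass (x : Φ.map.Vertex → ZMod 2) (y : Fin (2 * k) → ZMod 2) : Set α :=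
  {a | ∃ u, Sum.elim x y u = 1 ∧ (Φ.vertexEquiv u : α) = a}

theorem mem_colourClass_iff (x : Φ.map.Vertex → ZMod 2) (y : Fin (2 * k) → ZMod 2) (u : Φ.Vtx) :
    (Φ.vertexEquiv u : α) ∈ Φ.colourClass x y ↔ Sum.elim x y u = 1 := by
  constructor
  · rintro ⟨v, hv, h⟩
    rwa [← Φ.vertexEquiv.injective (Subtype.ext h)]
  · exact fun h => ⟨u, h, rfl⟩

theorem edge_mem_edgeCut_iff (x : Φ.map.Vertex → ZMod 2) (y : Fin (2 * k) → ZMod 2) (e : Φ.Edg) :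
    Φ.edge e ∈ SignedGraph.edgeCut G (Φ.colourClass x y) ↔ Φ.edgChange x y e ≠ 0 := by
  obtain ⟨u, v, h1, h2⟩ := Φ.exists_link e
  rw [SignedGraph.mem_edgeCut_iff h2, mem_colourClass_iff, mem_colourClass_iff,
    CanonicalData.edgChange_eq x y h1]
  generalize Sum.elim x y u = a
  generalize Sum.elim x y v = b
  revert a b
  decide

theorem edge_mem_negEdges_iff (e : Φ.Edg) :
    Φ.edge e ∈ SignedGraph.negEdges G π ↔ Φ.sign e = -1 := by
  rw [← Φ.sign_eq e]
  exact ⟨fun h => h.2, fun h => ⟨Φ.edge_mem e, h⟩⟩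

theorem edgeCut_inter_negEdges (x : Φ.map.Vertex → ZMod 2) (y : Fin (2 * k) → ZMod 2) :
    (SignedGraph.edgeCut G (Φ.colourClass x y) ∩ SignedGraph.negEdges G π).ncard =
      (CanonicalData.crossChanges y).ncard := by
  rw [← CanonicalData.ncard_cross_eq _ y x, ← Set.ncard_image_of_injective _ Φ.edge_injective]
  congr 1
  ext f
  constructor
  · rintro ⟨h1, h2⟩
    obtain ⟨e, rfl⟩ := Φ.exists_edge_eq h2.1
    exact ⟨e, ⟨(Φ.edge_mem_edgeCut_iff x y e).mp h1, (Φ.edge_mem_negEdges_iff e).mp h2⟩, rfl⟩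
  · rintro ⟨e, ⟨h1, h2⟩, rfl⟩
    exact ⟨(Φ.edge_mem_edgeCut_iff x y e).mpr h1, (Φ.edge_mem_negEdges_iff e).mpr h2⟩

theorem edgeCut_sdiff_negEdges [Finite D] (x : Φ.map.Vertex → ZMod 2) (y : Fin (2 * k) → ZMod 2) :
    (SignedGraph.edgeCut G (Φ.colourClass x y) \ SignedGraph.negEdges G π).ncard =
      (Φ.map.innerChanges Φ.outerFace x).ncard + (Φ.segChanges x y).ncard := by
  rw [← CanonicalData.ncard_pos_eq, ← Set.ncard_image_of_injective _ Φ.edge_injective]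
  congr 1
  ext f
  constructor
  · rintro ⟨h1, h2⟩
    obtain ⟨e, rfl⟩ := Φ.exists_edge_eq (SignedGraph.edgeCut_subset _ h1)
    exact ⟨e, ⟨(Φ.edge_mem_edgeCut_iff x y e).mp h1, mt (Φ.edge_mem_negEdges_iff e).mpr h2⟩, rfl⟩
  · rintro ⟨e, ⟨h1, h2⟩, rfl⟩
    exact ⟨(Φ.edge_mem_edgeCut_iff x y e).mpr h1, mt (Φ.edge_mem_negEdges_iff e).mp h2⟩

theorem ncard_negEdges (Φ : CanonicalEmbedding G π k D) : (SignedGraph.negEdges G π).ncard = k := by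
  have h : SignedGraph.negEdges G π = (fun a => Φ.edge (.cross a)) '' Set.univ := by
    ext f
    constructor
    · intro h
      obtain ⟨e, rfl⟩ := Φ.exists_edge_eq h.1
      rw [edge_mem_negEdges_iff] at h
      rcases e with _ | _ | _ | a
      · exact absurd h (by simp [CanonicalData.sign])
      · exact absurd h (by simp [CanonicalData.sign])
      · exact absurd h (by simp [CanonicalData.sign])
      · exact ⟨a, trivial, rfl⟩
    · rintro ⟨a, -, rfl⟩
      exact (Φ.edge_mem_negEdges_iff _).mpr rfl
  rw [h, Set.ncard_image_of_injective, Set.ncard_univ, Nat.card_fin]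
  intro a b hab
  exact CanonicalData.Edg.cross.inj (Φ.edge_injective hab)

variable {Φ}

/-- The cut inequality in terms of colourings. Every contradiction with minimality below is obtained
by changing a colouring and applying it. -/
theorem ncard_crossChanges_le [Finite D] (hG : SignedGraph.MemSStar k G σ)
    (hπ : SignedGraph.SwitchingEquiv G σ π) (x : Φ.map.Vertex → ZMod 2)
    (y : Fin (2 * k) → ZMod 2) :
    (CanonicalData.crossChanges y).ncard ≤
      (Φ.map.innerChanges Φ.outerFace x).ncard + (Φ.segChanges x y).ncard := by
  rw [← edgeCut_inter_negEdges, ← edgeCut_sdiff_negEdges]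
  exact SignedGraph.ncard_neg_le_ncard_pos hG.finite_edgeSet hG.critical hπ Φ.ncard_negEdges _

theorem exists_equilibrated [Finite D] (hG : SignedGraph.MemSStar k G σ)
    (hπ : SignedGraph.SwitchingEquiv G σ π) {e : Φ.map.Edge}
    (he : e ∉ Φ.map.faceEdges Φ.outerFace) : ∃ x y, Φ.map.coboundary x e ≠ 0 ∧
      (CanonicalData.crossChanges y).ncard =
      (Φ.map.innerChanges Φ.outerFace x).ncard + (Φ.segChanges x y).ncard := by
  classical
  obtain ⟨X, hX, hcard⟩ := SignedGraph.exists_equilibrated_cut hG.finite_edgeSet hG.critical hπ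
    Φ.ncard_negEdges (Φ.edge_mem (.inner e he))
    (by rw [edge_mem_negEdges_iff]; simp [CanonicalData.sign])
  let x : Φ.map.Vertex → ZMod 2 := fun v => if (Φ.vertexEquiv (.inl v) : α) ∈ X then 1 else 0
  let y : Fin (2 * k) → ZMod 2 := fun a => if (Φ.vertexEquiv (.inr a) : α) ∈ X then 1 else 0
  have h1 : SignedGraph.edgeCut G X = SignedGraph.edgeCut G (Φ.colourClass x y) := by
    have h2 : ∀ e, Φ.edge e ∈ SignedGraph.edgeCut G X ↔
        Φ.edge e ∈ SignedGraph.edgeCut G (Φ.colourClass x y) := by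
      intro e
      obtain ⟨u, v, -, h⟩ := Φ.exists_link e
      have h3 : ∀ u, (Φ.vertexEquiv u : α) ∈ X ↔ (Φ.vertexEquiv u : α) ∈ Φ.colourClass x y := by
        intro u
        rw [mem_colourClass_iff]
        rcases u with v | a
        · simp [x]
        · simp [y]
      rw [SignedGraph.mem_edgeCut_iff h, SignedGraph.mem_edgeCut_iff h, h3, h3]
    ext f
    constructor
    · intro hf
      obtain ⟨e, rfl⟩ := Φ.exists_edge_eq (SignedGraph.edgeCut_subset _ hf)
      exact (h2 e).mp hf
    · intro hf
      obtain ⟨e, rfl⟩ := Φ.exists_edge_eq (SignedGraph.edgeCut_subset _ hf)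
      exact (h2 e).mpr hf
  rw [h1] at hX hcard
  refine ⟨x, y, (Φ.edge_mem_edgeCut_iff x y _).mp hX, ?_⟩
  rw [← edgeCut_inter_negEdges, hcard, edgeCut_sdiff_negEdges]

end CanonicalEmbedding

/-! ### Cuts that meet the outer cycle in two given edges -/

namespace CombMap

variable {D : Type*} {M : CombMap D}

theorem minimalPeriod_face_pos [Finite D] (d : D) : 0 < Function.minimalPeriod M.face d := by
  refine Function.IsPeriodicPt.minimalPeriod_pos (orderOf_pos M.face) ?_
  change M.face^[orderOf M.face] d = d
  rw [Equiv.Perm.iterate_eq_pow, pow_orderOf_eq_one]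
  rfl

theorem faceOf_iterate (d : D) (j : ℕ) : M.faceOf (M.face^[j] d) = M.faceOf d := by
  induction j with
  | zero => rfl
  | succ j ih => rw [Function.iterate_succ_apply', faceOf_face, ih]

theorem exists_iterate_eq [Finite D] {d t : D} (h : M.faceOf t = M.faceOf d) :
    ∃ j < Function.minimalPeriod M.face d, M.face^[j] d = t := by
  have h1 : M.face.SameCycle d t := Quotient.exact h.symm
  obtain ⟨n, hn⟩ := h1.exists_nat_pow_eq
  refine ⟨n % Function.minimalPeriod M.face d, Nat.mod_lt _ (minimalPeriod_face_pos d), ?_⟩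
  rw [Function.iterate_mod_minimalPeriod_eq, Equiv.Perm.iterate_eq_pow, hn]

theorem iterate_inj {d : D} {i j : ℕ} (hi : i < Function.minimalPeriod M.face d)
    (hj : j < Function.minimalPeriod M.face d) : M.face^[i] d = M.face^[j] d ↔ i = j :=
  Function.iterate_eq_iterate_iff_of_lt_minimalPeriod hi hj

theorem coboundary_iterate (x : M.Vertex → ZMod 2) (d : D) (j : ℕ) :
    M.coboundary x (M.edgeOf (M.face^[j] d)) =
      x (M.vertexOf (M.face^[j] d)) + x (M.vertexOf (M.face^[j + 1] d)) := by
  rw [coboundary_edgeOf, Function.iterate_succ_apply', vertexOf_face]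

theorem coboundary_add_const (x : M.Vertex → ZMod 2) (c : ZMod 2) :
    M.coboundary (fun v => x v + c) = M.coboundary x := by
  ext e
  change (x _ + c) + (x _ + c) = x _ + x _
  rw [add_add_add_comm, CharTwo.add_self_eq_zero, add_zero]

/-- The boundary walk of a face cannot contain just one edge along which a colouring changes. -/
theorem exists_ne_coboundary_ne_zero [Finite D] (x : M.Vertex → ZMod 2) {t : D}
    (ht : M.coboundary x (M.edgeOf t) ≠ 0) :
    ∃ t', t' ≠ t ∧ M.faceOf t' = M.faceOf t ∧ M.coboundary x (M.edgeOf t') ≠ 0 := by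
  classical
  have := Fintype.ofFinite D
  by_contra! hcon
  have h := congrFun (M.faceSum_coboundary x) (M.faceOf t)
  rw [faceSum_apply, Finset.sum_eq_single t, if_pos rfl] at h
  · exact ht h
  · intro t' _ hne
    split_ifs with h1
    · exact hcon t' hne h1
    · rfl
  · exact fun h => absurd (Finset.mem_univ _) h

open Classical in
/-- The indicator function of a dart. -/
noncomputable def ind (b t : D) : ZMod 2 := if t = b then 1 else 0

theorem ind_iterate {d : D} {u j : ℕ} (hu : u < Function.minimalPeriod M.face d)
    (hj : j < Function.minimalPeriod M.face d) :
    ind (M.face^[u] d) (M.face^[j] d) = if j = u then 1 else 0 := by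
  simp only [ind, iterate_inj hj hu]

/-- There is a vertex colouring that changes on the boundary of the face `f` only along the edges
of `b` and `b'`, and along at most `n` other edges. -/
def HasCut (M : CombMap D) (f : M.Face) (b b' : D) (n : ℕ) : Prop :=
  ∃ x : M.Vertex → ZMod 2, (∀ t, M.faceOf t = f →
    M.coboundary x (M.edgeOf t) = ind b t + ind b' t) ∧ (M.innerChanges f x).ncard ≤ n

theorem HasCut.symm {f : M.Face} {b b' : D} {n : ℕ} (h : M.HasCut f b b' n) :
    M.HasCut f b' b n := by
  obtain ⟨x, hx, hn⟩ := h
  exact ⟨x, fun t ht => (hx t ht).trans (add_comm _ _), hn⟩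

theorem HasCut.mono {f : M.Face} {b b' : D} {n n' : ℕ} (h : M.HasCut f b b' n) (hn : n ≤ n') :
    M.HasCut f b b' n' := by
  obtain ⟨x, hx, h⟩ := h
  exact ⟨x, hx, h.trans hn⟩

theorem HasCut.trans [Finite D] {f : M.Face} {b b' b'' : D} {n n' : ℕ} (h : M.HasCut f b b' n)
    (h' : M.HasCut f b' b'' n') : M.HasCut f b b'' (n + n') := by
  obtain ⟨x, hx, hn⟩ := h
  obtain ⟨x', hx', hn'⟩ := h'
  refine ⟨x + x', fun t ht => ?_, ?_⟩
  · rw [map_add, Pi.add_apply, hx t ht, hx' t ht, add_assoc, ← add_assoc (ind b' t),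
      CharTwo.add_self_eq_zero, zero_add]
  · refine le_trans (Set.ncard_le_ncard ?_) ((Set.ncard_union_le _ _).trans (add_le_add hn hn'))
    rintro e ⟨he, hne⟩
    by_contra hcon
    simp only [Set.mem_union, innerChanges, Set.mem_ofPred_eq, not_or, not_and, not_not] at hcon
    rw [map_add, Pi.add_apply, hcon.1 he, hcon.2 he, add_zero] at hne
    exact hne rfl

/-- A colouring that changes on a face boundary along two edges, seen along the boundary walk. -/
theorem apply_iterate_eq {x : M.Vertex → ZMod 2} {d : D} {u t : ℕ}
    (hu : u < Function.minimalPeriod M.face d) (ht : t < Function.minimalPeriod M.face d)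
    (hx : ∀ s, M.faceOf s = M.faceOf d →
      M.coboundary x (M.edgeOf s) = ind (M.face^[u] d) s + ind (M.face^[t] d) s) :
    ∀ j ≤ Function.minimalPeriod M.face d, x (M.vertexOf (M.face^[j] d)) =
      x (M.vertexOf d) + (if u < j then 1 else 0) + (if t < j then 1 else 0) := by
  intro j
  induction j with
  | zero => simp
  | succ j ih =>
    intro hj
    have h1 := hx _ (faceOf_iterate d j)
    rw [coboundary_iterate, ih (by omega)] at h1
    rw [ind_iterate hu hj, ind_iterate ht hj] at h1
    have h2 : ∀ a b p q r s : ZMod 2, a + p + q + b = r + s → b = a + (p + r) + (q + s) := by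
      decide
    rw [h2 _ _ _ _ _ _ h1]
    have h3 : ∀ i, (if i < j then (1 : ZMod 2) else 0) + (if j = i then 1 else 0) =
        if i < j + 1 then 1 else 0 := by
      intro i
      split_ifs <;> first | decide | omega
    rw [h3, h3]

/-- Converse of `apply_iterate_eq`: it recognises a cut from the colours of the boundary vertices,
which is all that is known about an uncrossed colouring. -/
theorem coboundary_of_apply_iterate [Finite D] {x : M.Vertex → ZMod 2} {d : D} {u t : ℕ}
    (hu : u < Function.minimalPeriod M.face d) (ht : t < Function.minimalPeriod M.face d)
    {c : ZMod 2} (hx : ∀ j ≤ Function.minimalPeriod M.face d, x (M.vertexOf (M.face^[j] d)) =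
      c + (if u < j then 1 else 0) + (if t < j then 1 else 0)) :
    ∀ s, M.faceOf s = M.faceOf d →
      M.coboundary x (M.edgeOf s) = ind (M.face^[u] d) s + ind (M.face^[t] d) s := by
  intro s hs
  obtain ⟨j, hj, rfl⟩ := exists_iterate_eq hs
  rw [coboundary_iterate, hx j hj.le, hx (j + 1) hj]
  rw [ind_iterate hu hj, ind_iterate ht hj]
  have h2 : ∀ c a b p q : ZMod 2, c + a + b + (c + p + q) = (a + p) + (b + q) := by
    decide
  have h3 : ∀ i, (if i < j then (1 : ZMod 2) else 0) + (if i < j + 1 then 1 else 0) =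
      if j = i then 1 else 0 := by
    intro i
    split_ifs <;> first | decide | omega
  rw [h2, h3, h3]

/-- Submodularity of the number of inner changes. -/
theorem ncard_innerChanges_add_le [Finite D] {f : M.Face} {F F' : ZMod 2 → ZMod 2 → ZMod 2}
    (hF : ∀ a a' b b', F a b ≠ F a' b' → a ≠ a' ∨ b ≠ b')
    (hF' : ∀ a a' b b', F' a b ≠ F' a' b' → a ≠ a' ∨ b ≠ b')
    (hFF' : ∀ a a' b b', F a b ≠ F a' b' → F' a b ≠ F' a' b' → a ≠ a' ∧ b ≠ b')
    (x x' : M.Vertex → ZMod 2) :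
    (M.innerChanges f fun v => F (x v) (x' v)).ncard +
      (M.innerChanges f fun v => F' (x v) (x' v)).ncard ≤
      (M.innerChanges f x).ncard + (M.innerChanges f x').ncard := by
  have hne : ∀ (w : M.Vertex → ZMod 2) e, M.coboundary w e ≠ 0 ↔
      w (M.vertexOf e.out) ≠ w (M.vertexOf (M.rev e.out)) :=
    fun w e => not_congr CharTwo.add_eq_zero
  -- Both sides are sizes of a union plus an intersection: `hF` and `hF'` compare the unions, `hFF'`
  -- the intersections.
  rw [← Set.ncard_union_add_ncard_inter, ← Set.ncard_union_add_ncard_inter (M.innerChanges f x)]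
  refine add_le_add (Set.ncard_le_ncard ?_) (Set.ncard_le_ncard ?_)
  · rintro e (⟨he, h⟩ | ⟨he, h⟩)
    · rw [hne] at h
      exact (hF _ _ _ _ h).imp (fun h => ⟨he, (hne _ _).mpr h⟩) (fun h => ⟨he, (hne _ _).mpr h⟩)
    · rw [hne] at h
      exact (hF' _ _ _ _ h).imp (fun h => ⟨he, (hne _ _).mpr h⟩) (fun h => ⟨he, (hne _ _).mpr h⟩)
  · rintro e ⟨⟨he, h⟩, ⟨-, h'⟩⟩
    rw [hne] at h h'
    exact (hFF' _ _ _ _ h h').imp (fun h => ⟨he, (hne _ _).mpr h⟩) (fun h => ⟨he, (hne _ _).mpr h⟩)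

/-- Adding a constant fixes the colour at `d`. The colours on the face boundary are then known, so
two cuts can be combined vertex by vertex. -/
theorem HasCut.exists_normalized [Finite D] {d : D} {u t n : ℕ}
    (hu : u < Function.minimalPeriod M.face d) (ht : t < Function.minimalPeriod M.face d)
    (h : M.HasCut (M.faceOf d) (M.face^[u] d) (M.face^[t] d) n) :
    ∃ x : M.Vertex → ZMod 2, (∀ j ≤ Function.minimalPeriod M.face d,
      x (M.vertexOf (M.face^[j] d)) = (if u < j then 1 else 0) + (if t < j then 1 else 0)) ∧
      (M.innerChanges (M.faceOf d) x).ncard ≤ n := by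
  obtain ⟨x, hx, hn⟩ := h
  refine ⟨fun v => x v + x (M.vertexOf d), fun j hj => ?_, ?_⟩
  · change x _ + _ = _
    rw [apply_iterate_eq hu ht hx j hj, add_comm, ← add_assoc, ← add_assoc,
      CharTwo.add_self_eq_zero, zero_add]
  · unfold innerChanges
    rwa [coboundary_add_const]

section Uncrossing

variable [Finite D] {d : D} {u₁ u₂ t₁ t₂ n₁ n₂ : ℕ}

/-- Uncrossing of two crossing cuts by intersection and union. -/
theorem HasCut.uncross_inter_union (hu : u₁ < u₂) (hut : u₂ < t₁) (ht : t₁ < t₂)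
    (hm : t₂ < Function.minimalPeriod M.face d)
    (h₁ : M.HasCut (M.faceOf d) (M.face^[u₁] d) (M.face^[t₁] d) n₁)
    (h₂ : M.HasCut (M.faceOf d) (M.face^[u₂] d) (M.face^[t₂] d) n₂) :
    ∃ a b, a + b ≤ n₁ + n₂ ∧ M.HasCut (M.faceOf d) (M.face^[u₂] d) (M.face^[t₁] d) a ∧
      M.HasCut (M.faceOf d) (M.face^[u₁] d) (M.face^[t₂] d) b := by
  obtain ⟨x₁, hx₁, hn₁⟩ := h₁.exists_normalized (by omega) (by omega)
  obtain ⟨x₂, hx₂, hn₂⟩ := h₂.exists_normalized (by omega) (by omega)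
  -- Over `ZMod 2` these are the indicators of the intersection and the union of the colour classes.
  refine ⟨_, _, (ncard_innerChanges_add_le (F := fun a b => a * b)
    (F' := fun a b => a + b + a * b) (by decide) (by decide) (by decide) x₁ x₂).trans
    (add_le_add hn₁ hn₂), ⟨_, coboundary_of_apply_iterate (c := 0) (by omega) (by omega) ?_, le_rfl⟩,
    ⟨_, coboundary_of_apply_iterate (c := 0) (by omega) (by omega) ?_, le_rfl⟩⟩
  · intro j hj
    simp only [hx₁ j hj, hx₂ j hj]
    split_ifs <;> first | decide | omega
  · intro j hj
    simp only [hx₁ j hj, hx₂ j hj]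
    split_ifs <;> first | decide | omega

/-- Uncrossing of two crossing cuts by the two differences. -/
theorem HasCut.uncross_sdiff (hu : u₁ < u₂) (hut : u₂ < t₁) (ht : t₁ < t₂)
    (hm : t₂ < Function.minimalPeriod M.face d)
    (h₁ : M.HasCut (M.faceOf d) (M.face^[u₁] d) (M.face^[t₁] d) n₁)
    (h₂ : M.HasCut (M.faceOf d) (M.face^[u₂] d) (M.face^[t₂] d) n₂) :
    ∃ a b, a + b ≤ n₁ + n₂ ∧ M.HasCut (M.faceOf d) (M.face^[u₁] d) (M.face^[u₂] d) a ∧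
      M.HasCut (M.faceOf d) (M.face^[t₁] d) (M.face^[t₂] d) b := by
  obtain ⟨x₁, hx₁, hn₁⟩ := h₁.exists_normalized (by omega) (by omega)
  obtain ⟨x₂, hx₂, hn₂⟩ := h₂.exists_normalized (by omega) (by omega)
  -- The indicators of the two set differences.
  refine ⟨_, _, (ncard_innerChanges_add_le (F := fun a b => a * (1 + b))
    (F' := fun a b => (1 + a) * b) (by decide) (by decide) (by decide) x₁ x₂).trans
    (add_le_add hn₁ hn₂), ⟨_, coboundary_of_apply_iterate (c := 0) (by omega) (by omega) ?_, le_rfl⟩,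
    ⟨_, coboundary_of_apply_iterate (c := 0) (by omega) (by omega) ?_, le_rfl⟩⟩
  · intro j hj
    simp only [hx₁ j hj, hx₂ j hj]
    split_ifs <;> first | decide | omega
  · intro j hj
    simp only [hx₁ j hj, hx₂ j hj]
    split_ifs <;> first | decide | omega

end Uncrossing

end CombMap

/-! ### Cuts of normal canonical embeddings -/

namespace SubdividedCycle

variable {m n : ℕ} {pos : Fin n → Fin m}

theorem change_congr {g g' : ℕ → ZMod 2} (h : ∀ j ≤ m, g j = g' j) (y : Fin n → ZMod 2)
    (s : Fin m ⊕ Fin n) : change pos g y s = change pos g' y s := by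
  have h1 : startVal g y s = startVal g' y s := by
    rcases s with j | a
    · exact h j j.2.le
    · rfl
  have h2 : endVal pos g y s = endVal pos g' y s := by
    unfold endVal
    rw [h _ (edgeIdx_lt s)]
  rw [change, change, h1, h2]

theorem change_add (g g' : ℕ → ZMod 2) (y y' : Fin n → ZMod 2) (s : Fin m ⊕ Fin n) :
    change pos (fun j => g j + g' j) (fun a => y a + y' a) s =
      change pos g y s + change pos g' y' s := by
  have h := change_add_sum (pos := pos) {()} (fun _ => 1) g y (fun _ => g') (fun _ => y') s
  simpa using h

end SubdividedCycle

namespace CanonicalData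

variable {k : ℕ} {D : Type*} {Φ : CanonicalData k D}

open SubdividedCycle

theorem crossChanges_congr {y y' : Fin (2 * k) → ZMod 2} (c : ZMod 2) (h : ∀ a, y a = c + y' a) :
    crossChanges y = crossChanges y' := by
  ext a
  have h2 : ∀ c p q : ZMod 2, c + p + (c + q) = p + q := by decide
  simp only [crossChanges, Set.mem_ofPred_eq, h, h2]

theorem faceOf_bdryDart (j : ℕ) : Φ.map.faceOf (Φ.bdryDart j) = Φ.outerFace :=
  CombMap.faceOf_iterate _ _

theorem exists_bdryDart_eq [Finite D] {t : D} (ht : Φ.map.faceOf t = Φ.outerFace) :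
    ∃ j : Fin (Function.minimalPeriod Φ.map.face Φ.root), Φ.bdryDart j = t := by
  obtain ⟨j, hj, h⟩ := CombMap.exists_iterate_eq ht
  exact ⟨⟨j, hj⟩, h⟩

theorem bdryDart_inj {i j : Fin (Function.minimalPeriod Φ.map.face Φ.root)} :
    Φ.bdryDart i = Φ.bdryDart j ↔ i = j :=
  (CombMap.iterate_inj i.2 j.2).trans Fin.ext_iff.symm

theorem bdryDart_succ (j : ℕ) : Φ.bdryDart (j + 1) = Φ.map.face (Φ.bdryDart j) :=
  Function.iterate_succ_apply' _ _ _

theorem coboundary_bdryDart (x : Φ.map.Vertex → ZMod 2) (j : ℕ) :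
    Φ.map.coboundary x (Φ.map.edgeOf (Φ.bdryDart j)) = x (Φ.corner j) + x (Φ.corner (j + 1)) :=
  CombMap.coboundary_iterate x Φ.root j

theorem pos_ne_of_weight_eq_zero {j : ℕ} (h : Φ.weight (Φ.bdryDart j) = 0) (a : Fin (2 * k)) :
    (Φ.pos a : ℕ) ≠ j := by
  intro hj
  rw [weight, Set.ncard_eq_zero] at h
  exact Set.notMem_empty a (h ▸ (show Φ.bdryDart (Φ.pos a) = Φ.bdryDart j by rw [hj]))

theorem endVal_of_weight_eq_zero {s : Φ.Seg} {j : ℕ} (hs : edgeIdx Φ.pos s = j)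
    (h : Φ.weight (Φ.bdryDart j) = 0) (g : ℕ → ZMod 2) (y : Fin (2 * k) → ZMod 2) :
    endVal Φ.pos g y s = g (j + 1) := by
  subst hs
  rw [endVal, dif_neg]
  rintro ⟨h1, h2⟩
  exact pos_ne_of_weight_eq_zero h _ h2

theorem segChange_of_weight_eq_zero {j : Fin (Function.minimalPeriod Φ.map.face Φ.root)}
    (h : Φ.weight (Φ.bdryDart j) = 0) (x : Φ.map.Vertex → ZMod 2) (y : Fin (2 * k) → ZMod 2) :
    Φ.segChange x y (.inl j) = Φ.map.coboundary x (Φ.map.edgeOf (Φ.bdryDart j)) := by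
  rw [segChange, change, endVal_of_weight_eq_zero rfl h, coboundary_bdryDart]
  rfl

theorem edgeOf_notMem {t : D} (h : Φ.map.faceOf t ≠ Φ.outerFace)
    (h' : Φ.map.faceOf (Φ.map.rev t) ≠ Φ.outerFace) :
    Φ.map.edgeOf t ∉ Φ.map.faceEdges Φ.outerFace := by
  rintro ⟨s, hs, hst⟩
  rcases Φ.map.eq_or_eq_rev_of_edgeOf_eq hst.symm with rfl | rfl
  · exact h hs
  · exact h' hs

theorem faceOf_ne_of_notMem {t : D} (h : Φ.map.edgeOf t ∉ Φ.map.faceEdges Φ.outerFace) :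
    Φ.map.faceOf t ≠ Φ.outerFace ∧ Φ.map.faceOf (Φ.map.rev t) ≠ Φ.outerFace :=
  ⟨fun h1 => h ⟨t, h1, rfl⟩, fun h1 => h ⟨_, h1, Φ.map.edgeOf_rev t⟩⟩

end CanonicalData

namespace CanonicalEmbedding

variable {α β D : Type*} [Finite D] {G : Graph α β} {σ π : β → ℤˣ} {k : ℕ}
  {Φ : CanonicalEmbedding G π k D}

open SubdividedCycle CanonicalData

/-- The inserted points can be coloured so that `C'` changes only along the segments `s` and `s'`.
The cut then has at most `n + 2` positive edges, which bounds the number of separated opposite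
pairs. -/
theorem crossChanges_le_of_hasCut (hG : SignedGraph.MemSStar k G σ)
    (hπ : SignedGraph.SwitchingEquiv G σ π) {s s' : Φ.Seg} {n : ℕ}
    (h : Φ.map.HasCut Φ.outerFace (Φ.bdryDart (edgeIdx Φ.pos s)) (Φ.bdryDart (edgeIdx Φ.pos s'))
      n) :
    (crossChanges fun a => pointAfter Φ.pos s a + pointAfter Φ.pos s' a).ncard ≤ n + 2 := by
  classical
  obtain ⟨x, hx, hn⟩ := CombMap.HasCut.exists_normalized (edgeIdx_lt s) (edgeIdx_lt s') h
  refine (ncard_crossChanges_le hG hπ x _).trans (add_le_add hn ?_)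
  have h1 : Φ.segChanges x (fun a => pointAfter Φ.pos s a + pointAfter Φ.pos s' a) ⊆ {s, s'} := by
    intro r hr
    have h2 := change_congr (pos := Φ.pos)
      (g := fun j => x (Φ.corner j)) (g' := fun j => cornerAfter Φ.pos s j + cornerAfter Φ.pos s' j)
      hx (fun a => pointAfter Φ.pos s a + pointAfter Φ.pos s' a) r
    rw [change_add, change_after Φ.pos_mono, change_after Φ.pos_mono] at h2
    by_contra hcon
    simp only [Set.mem_insert_iff, Set.mem_singleton_iff, not_or] at hcon
    rw [if_neg hcon.1, if_neg hcon.2, add_zero] at h2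
    exact hr h2
  exact (Set.ncard_le_ncard h1).trans ((Set.ncard_insert_le _ _).trans (by simp))

/-- The inner edges of an equilibrated cut do not contain the dual of an even graph. -/
theorem false_of_faceSum_eq_zero [Fintype D] (hG : SignedGraph.MemSStar k G σ)
    (hπ : SignedGraph.SwitchingEquiv G σ π) {x : Φ.map.Vertex → ZMod 2}
    {y : Fin (2 * k) → ZMod 2}
    (hxy : (crossChanges y).ncard =
      (Φ.map.innerChanges Φ.outerFace x).ncard + (Φ.segChanges x y).ncard)
    {c : Φ.map.Edge → ZMod 2} (hc : Φ.map.faceSum c = 0)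
    (hcx : ∀ e, c e ≠ 0 → e ∈ Φ.map.innerChanges Φ.outerFace x) {e : Φ.map.Edge}
    (he : c e ≠ 0) : False := by
  -- By planarity `c` is itself a cut, and it avoids `C'`; so its colouring can be taken to vanish
  -- on `C'`. Adding it to `x` deletes the edges of `c` and leaves the segments and the negative
  -- edges alone.
  obtain ⟨w', hw'⟩ := Φ.map.exists_coboundary_eq Φ.isPlane hc
  obtain ⟨w, hw, hw0⟩ : ∃ w, Φ.map.coboundary w = c ∧ w (Φ.corner 0) = 0 :=
    ⟨fun v => w' v + w' (Φ.corner 0), by rw [CombMap.coboundary_add_const, hw'],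
      CharTwo.add_self_eq_zero _⟩
  have hcorner : ∀ j, w (Φ.corner j) = 0 := by
    intro j
    induction j with
    | zero => exact hw0
    | succ j ih =>
      have h1 := coboundary_bdryDart (Φ := Φ.toCanonicalData) w j
      rw [ih, zero_add, hw] at h1
      by_contra h2
      rw [← h1] at h2
      exact (hcx _ h2).1 ⟨_, faceOf_bdryDart j, rfl⟩
  have h1 := ncard_crossChanges_le hG hπ (x + w) y (Φ := Φ)
  have h2 : Φ.segChanges (x + w) y = Φ.segChanges x y := by
    ext r
    have h3 : Φ.segChange (x + w) y r = Φ.segChange x y r := by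
      refine change_congr (fun j _ => ?_) y r
      rw [Pi.add_apply, hcorner, add_zero]
    change Φ.segChange (x + w) y r ≠ 0 ↔ Φ.segChange x y r ≠ 0
    rw [h3]
  have h3 : Φ.map.innerChanges Φ.outerFace (x + w) ⊂ Φ.map.innerChanges Φ.outerFace x := by
    refine ⟨?_, fun h => ?_⟩
    · rintro e ⟨he, hne⟩
      by_cases hce : c e = 0
      · rw [map_add, Pi.add_apply, hw, hce, add_zero] at hne
        exact ⟨he, hne⟩
      · exact hcx e hce
    · have h4 := (h (hcx e he)).2
      have h5 := (hcx e he).2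
      rw [map_add, Pi.add_apply, hw] at h4
      have h6 : ∀ a b : ZMod 2, a + b ≠ 0 → a ≠ 0 → b ≠ 0 → False := by decide
      exact h6 _ _ h4 h5 he
  have h4 := Set.ncard_lt_ncard h3
  rw [h2] at h1
  omega

end CanonicalEmbedding

/-! ### The inner edge at the common end of two edges of weight 0 -/

namespace CombMap

variable {D : Type*} {M : CombMap D}

theorem IsCubic.rot_rot_face (hM : M.IsCubic) (d : D) :
    M.rot (M.rot (M.face d)) = M.rev d := by
  rw [face_apply, hM.rot_rot_rot]

theorem IsCubic.faceOf_rev_rot_face (hM : M.IsCubic) (d : D) :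
    M.faceOf (M.rev (M.rot (M.face d))) = M.faceOf (M.rev d) := by
  rw [← faceOf_face, face_rev, hM.rot_rot_face]

end CombMap

namespace CanonicalEmbedding

variable {α β D : Type*} [Finite D] {G : Graph α β} {σ π : β → ℤˣ} {k : ℕ}
  {Φ : CanonicalEmbedding G π k D}

open SubdividedCycle CanonicalData

theorem faceOf_rev_ne_outerFace {t : D} (ht : Φ.map.faceOf t = Φ.outerFace) :
    Φ.map.faceOf (Φ.map.rev t) ≠ Φ.outerFace := by
  rw [← ht]
  exact CombMap.faceOf_rev_ne Φ.isPlane Φ.isCubic Φ.isTwoConnected t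

theorem edgeOf_rot_face_notMem {b : D} (hb : Φ.map.faceOf b = Φ.outerFace) :
    Φ.map.edgeOf (Φ.map.rot (Φ.map.face b)) ∉ Φ.map.faceEdges Φ.outerFace := by
  apply edgeOf_notMem
  · rw [CombMap.faceOf_rot]
    exact faceOf_rev_ne_outerFace (by rw [CombMap.faceOf_face, hb])
  · rw [Φ.isCubic.faceOf_rev_rot_face]
    exact faceOf_rev_ne_outerFace hb

/-- An equilibrated cut that contains the inner edge at the common end of two edges of `C'` of
weight `0` contains neither of them. -/
theorem coboundary_eq_zero_of_weight_eq_zero (hG : SignedGraph.MemSStar k G σ)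
    (hπ : SignedGraph.SwitchingEquiv G σ π) {x : Φ.map.Vertex → ZMod 2}
    {y : Fin (2 * k) → ZMod 2}
    (hxy : (crossChanges y).ncard =
      (Φ.map.innerChanges Φ.outerFace x).ncard + (Φ.segChanges x y).ncard)
    {b : D} (hb : Φ.map.faceOf b = Φ.outerFace) (hwb : Φ.weight b = 0)
    (hwc : Φ.weight (Φ.map.face b) = 0)
    (hg : Φ.map.coboundary x (Φ.map.edgeOf (Φ.map.rot (Φ.map.face b))) ≠ 0) :
    Φ.map.coboundary x (Φ.map.edgeOf b) = 0 ∧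
      Φ.map.coboundary x (Φ.map.edgeOf (Φ.map.face b)) = 0 := by
  classical
  set c := Φ.map.face b with hcdef
  set g := Φ.map.rot c
  have hc : Φ.map.faceOf c = Φ.outerFace := by rw [hcdef, CombMap.faceOf_face, hb]
  have hgin : Φ.map.edgeOf g ∉ Φ.map.faceEdges Φ.outerFace := edgeOf_rot_face_notMem hb
  -- Adding `w` moves only the common end of the two edges to the other side; this affects just the
  -- three edges there, as no point is inserted on `b` or `c`.
  set w : Φ.map.Vertex → ZMod 2 := Pi.single (Φ.map.vertexOf c) 1 with hw
  have hwself : w (Φ.map.vertexOf c) = 1 := Pi.single_eq_same _ _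
  have hwne : ∀ {v}, v ≠ Φ.map.vertexOf c → w v = 0 := fun h => Pi.single_eq_of_ne h _
  have hrev : ∀ t, Φ.map.vertexOf (Φ.map.rev t) ≠ Φ.map.vertexOf t :=
    CombMap.vertexOf_rev_ne Φ.isTwoConnected
  have hvb : Φ.map.vertexOf (Φ.map.rev b) = Φ.map.vertexOf c := (Φ.map.vertexOf_face b).symm
  have hcw_b : Φ.map.coboundary w (Φ.map.edgeOf b) = 1 := by
    rw [CombMap.coboundary_edgeOf, hvb, hwself, hwne, zero_add]
    rw [← hvb]
    exact (hrev b).symm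
  have hcw_c : Φ.map.coboundary w (Φ.map.edgeOf c) = 1 := by
    rw [CombMap.coboundary_edgeOf, hwself, hwne (hrev c), add_zero]
  have hcw_g : Φ.map.coboundary w (Φ.map.edgeOf g) = 1 := by
    have h1 : Φ.map.vertexOf g = Φ.map.vertexOf c := Φ.map.vertexOf_rot c
    rw [CombMap.coboundary_edgeOf, h1, hwself, hwne, add_zero]
    rw [← h1]
    exact hrev g
  have hdart : ∀ t, Φ.map.vertexOf t = Φ.map.vertexOf c →
      Φ.map.edgeOf t ∉ Φ.map.faceEdges Φ.outerFace → Φ.map.edgeOf t = Φ.map.edgeOf g := by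
    intro t ht hin
    rcases Φ.isCubic.eq_of_vertexOf_eq ht with rfl | rfl | rfl
    · exact absurd ⟨c, hc, rfl⟩ hin
    · rfl
    · rw [hcdef, Φ.isCubic.rot_rot_face, Φ.map.edgeOf_rev] at hin
      exact absurd ⟨b, hb, rfl⟩ hin
  have hcw_inner : ∀ e, e ∉ Φ.map.faceEdges Φ.outerFace → e ≠ Φ.map.edgeOf g →
      Φ.map.coboundary w e = 0 := by
    intro e he hne
    obtain ⟨t, rfl⟩ : ∃ t, Φ.map.edgeOf t = e := Quotient.exists_rep e
    rw [CombMap.coboundary_edgeOf, hwne, hwne, add_zero]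
    · intro h
      exact hne (by rw [← Φ.map.edgeOf_rev]; exact hdart _ h (by rwa [Φ.map.edgeOf_rev]))
    · exact fun h => hne (hdart t h he)
  have hinner : Φ.map.innerChanges Φ.outerFace (x + w) ⊂ Φ.map.innerChanges Φ.outerFace x := by
    refine ⟨?_, fun h => ?_⟩
    · rintro e ⟨he, hne⟩
      rw [map_add, Pi.add_apply] at hne
      by_cases heg : e = Φ.map.edgeOf g
      · exact ⟨he, heg ▸ hg⟩
      · rw [hcw_inner e he heg, add_zero] at hne
        exact ⟨he, hne⟩
    · have h1 := (h ⟨hgin, hg⟩).2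
      rw [map_add, Pi.add_apply, hcw_g] at h1
      revert h1 hg
      generalize Φ.map.coboundary x (Φ.map.edgeOf g) = p
      revert p
      decide
  have hinner_lt := Set.ncard_lt_ncard hinner
  obtain ⟨ib, hib⟩ := exists_bdryDart_eq hb
  obtain ⟨ic, hic⟩ := exists_bdryDart_eq hc
  have hcorner : ∀ j, w (Φ.corner j) ≠ 0 → Φ.bdryDart j = c := by
    intro j hj
    by_contra hne
    refine hj (hwne fun h => hne ?_)
    exact CombMap.eq_of_vertexOf_eq_of_faceOf_eq Φ.isPlane Φ.isCubic Φ.isTwoConnected h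
      ((faceOf_bdryDart j).trans hc.symm)
  have hseg : ∀ r : Φ.Seg, r ≠ .inl ib → r ≠ .inl ic →
      Φ.segChange (x + w) y r = Φ.segChange x y r := by
    intro r hrb hrc
    have h1 : change Φ.pos (fun j => w (Φ.corner j)) 0 r = 0 := by
      have h2 : startVal (fun j => w (Φ.corner j)) (0 : Fin (2 * k) → ZMod 2) r = 0 := by
        rcases r with j | a
        · by_contra h3
          have h4 := hcorner j h3
          rw [← hic, bdryDart_inj] at h4
          exact hrc (by rw [h4])
        · rfl
      have h3 : endVal Φ.pos (fun j => w (Φ.corner j)) (0 : Fin (2 * k) → ZMod 2) r = 0 := by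
        unfold endVal
        split_ifs with h4
        · rfl
        · by_contra h5
          have h6 := hcorner _ h5
          rw [bdryDart_succ, hcdef, Φ.map.face.apply_eq_iff_eq, ← hib] at h6
          have h7 := (bdryDart_inj (i := ⟨_, edgeIdx_lt (pos := Φ.pos) r⟩)).mp h6
          rcases r with j | a
          · exact hrb (by rw [← h7]; rfl)
          · exact pos_ne_of_weight_eq_zero (Φ := Φ.toCanonicalData) (j := ib) (by rw [hib, hwb]) a
              (congrArg Fin.val h7)
      rw [change, h2, h3, add_zero]
    have h2 := change_add (pos := Φ.pos) (fun j => x (Φ.corner j)) (fun j => w (Φ.corner j)) y 0 r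
    rw [h1, add_zero] at h2
    rw [segChange, segChange, ← h2]
    simp
  have hsb : Φ.segChange (x + w) y (.inl ib) = Φ.map.coboundary x (Φ.map.edgeOf b) + 1 := by
    rw [segChange_of_weight_eq_zero (by rw [hib, hwb]), hib, map_add, Pi.add_apply, hcw_b]
  have hsc : Φ.segChange (x + w) y (.inl ic) = Φ.map.coboundary x (Φ.map.edgeOf c) + 1 := by
    rw [segChange_of_weight_eq_zero (by rw [hic, hwc]), hic, map_add, Pi.add_apply, hcw_c]
  have hsb' : Φ.segChange x y (.inl ib) = Φ.map.coboundary x (Φ.map.edgeOf b) := by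
    rw [segChange_of_weight_eq_zero (by rw [hib, hwb]), hib]
  have hsc' : Φ.segChange x y (.inl ic) = Φ.map.coboundary x (Φ.map.edgeOf c) := by
    rw [segChange_of_weight_eq_zero (by rw [hic, hwc]), hic]
  have hbound := ncard_crossChanges_le hG hπ (Φ := Φ) (x + w) y
  have h01 : ∀ p : ZMod 2, p ≠ 0 → p + 1 = 0 := by decide
  -- If segment `i` is in the cut, the move loses `g` and `i` and gains at most `j`, so fewer
  -- positive edges face the same negative ones.
  have hcard : ∀ i j : Φ.Seg, (∀ r : Φ.Seg, r ≠ i → r ≠ j →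
      Φ.segChange (x + w) y r = Φ.segChange x y r) → Φ.segChange x y i ≠ 0 →
      Φ.segChange (x + w) y i = 0 → False := by
    intro i j hij hi hi'
    have h1 : Φ.segChanges (x + w) y ⊆ insert j (Φ.segChanges x y \ {i}) := by
      intro r hr
      by_cases hrj : r = j
      · exact Or.inl hrj
      by_cases hri : r = i
      · rw [hri] at hr
        exact absurd hi' hr
      · refine Or.inr ⟨?_, hri⟩
        change Φ.segChange x y r ≠ 0
        rw [← hij r hri hrj]
        exact hr
    have h2 := (Set.ncard_le_ncard h1).trans (Set.ncard_insert_le _ _)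
    rw [Set.ncard_sdiff_singleton_add_one (show i ∈ Φ.segChanges x y from hi)] at h2
    omega
  constructor
  · by_contra hp
    exact hcard (.inl ib) (.inl ic) hseg (hsb' ▸ hp) (by rw [hsb, h01 _ hp])
  · by_contra hp
    exact hcard (.inl ic) (.inl ib) (fun r h1 h2 => hseg r h2 h1) (hsc' ▸ hp)
      (by rw [hsc, h01 _ hp])

end CanonicalEmbedding

namespace CanonicalData

open SubdividedCycle

variable {k : ℕ} {D : Type*}

/-- The outer cycle has an even number of segments along which a colouring changes. -/
theorem even_ncard_segChanges (Φ : CanonicalData k D) (x : Φ.map.Vertex → ZMod 2)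
    (y : Fin (2 * k) → ZMod 2) : Even (Φ.segChanges x y).ncard := by
  classical
  have h1 := (eq_add_sum_change Φ.pos_mono (fun j => x (Φ.corner j)) y).1 _ le_rfl
  -- The walk closes up, so the changes along all segments add up to zero.
  have h2 : Φ.corner (Function.minimalPeriod Φ.map.face Φ.root) = Φ.corner 0 :=
    congrArg Φ.map.vertexOf Function.iterate_minimalPeriod
  rw [h2, left_eq_add] at h1
  have h3 : ∀ s : Φ.Seg, change Φ.pos (fun j => x (Φ.corner j)) y s *
      cornerAfter Φ.pos s (Function.minimalPeriod Φ.map.face Φ.root) =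
      if s ∈ Φ.segChanges x y then 1 else 0 := by
    intro s
    rw [cornerAfter, if_pos (edgeIdx_lt s), mul_one]
    split_ifs with h4
    · have h5 : ∀ p : ZMod 2, p ≠ 0 → p = 1 := by decide
      exact h5 _ h4
    · exact not_not.mp h4
  rw [Finset.sum_congr rfl fun s _ => h3 s, Finset.sum_boole, ZMod.natCast_eq_zero_iff_even] at h1
  rw [Set.ncard_eq_toFinset_card']
  convert! h1
  ext s
  simp

end CanonicalData

namespace CanonicalEmbedding

variable {α β D : Type*} [Finite D] {G : Graph α β} {σ π : β → ℤˣ} {k : ℕ}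
  {Φ : CanonicalEmbedding G π k D}

open SubdividedCycle CanonicalData

/-- If the boundary face of `b` contains a changing edge, but `b` does not change, then the face
contains another changing edge, and this edge is inner. -/
theorem exists_inner_change (hΦ : Φ.IsNormal) {x : Φ.map.Vertex → ZMod 2} {b t : D}
    (hb : Φ.map.faceOf b = Φ.outerFace) (hxb : Φ.map.coboundary x (Φ.map.edgeOf b) = 0)
    (ht : Φ.map.faceOf t = Φ.map.faceOf (Φ.map.rev b))
    (hxt : Φ.map.coboundary x (Φ.map.edgeOf t) ≠ 0) :
    ∃ t', t' ≠ t ∧ Φ.map.faceOf t' = Φ.map.faceOf (Φ.map.rev b) ∧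
      Φ.map.edgeOf t' ∈ Φ.map.innerChanges Φ.outerFace x := by
  obtain ⟨t', hne, hf, hx'⟩ := CombMap.exists_ne_coboundary_ne_zero x hxt
  rw [ht] at hf
  refine ⟨t', hne, hf, edgeOf_notMem (hf ▸ faceOf_rev_ne_outerFace hb) ?_, hx'⟩
  intro h1
  -- Normality: an edge of this face on `C'` can only be `b`, which does not change.
  have h2 : Φ.map.rev t' = b := hΦ.eq_of_faceOf_rev_eq h1 hb (by rw [Φ.map.rev_rev, hf])
  rw [← Φ.map.edgeOf_rev, h2] at hx'
  exact hx' hxb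

/-- A single inner edge between the boundary faces of `a` and `b` gives a cut. -/
theorem hasCut_one {a b t : D} (ha : Φ.map.faceOf a = Φ.outerFace)
    (hb : Φ.map.faceOf b = Φ.outerFace) (ht : Φ.map.edgeOf t ∉ Φ.map.faceEdges Φ.outerFace)
    (hta : Φ.map.faceOf t = Φ.map.faceOf (Φ.map.rev a))
    (htb : Φ.map.faceOf (Φ.map.rev t) = Φ.map.faceOf (Φ.map.rev b)) :
    Φ.map.HasCut Φ.outerFace a b 1 := by
  classical
  have := Fintype.ofFinite D
  -- In the dual, the edges `t`, `a`, `b` join the two boundary faces and the outer face in a closed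
  -- walk, so all face sums cancel.
  obtain ⟨x, hx⟩ := Φ.map.exists_coboundary_eq Φ.isPlane
    (s := Pi.single (Φ.map.edgeOf t) 1 + Pi.single (Φ.map.edgeOf a) 1 +
      Pi.single (Φ.map.edgeOf b) 1) (by
    rw [map_add, map_add, CombMap.faceSum_single, CombMap.faceSum_single, CombMap.faceSum_single,
      hta, htb, ha, hb]
    ext f
    simp only [Pi.add_apply, Pi.zero_apply]
    generalize (Pi.single (Φ.map.faceOf (Φ.map.rev a)) 1 : _ → ZMod 2) f = p
    generalize (Pi.single (Φ.map.faceOf (Φ.map.rev b)) 1 : _ → ZMod 2) f = q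
    generalize (Pi.single Φ.outerFace 1 : _ → ZMod 2) f = r
    revert p q r
    decide)
  refine ⟨x, fun s hs => ?_, ?_⟩
  · have h1 : Φ.map.edgeOf s ≠ Φ.map.edgeOf t := fun h => ht ⟨s, hs, h⟩
    have h2 : ∀ c, Φ.map.faceOf c = Φ.outerFace →
        (Pi.single (Φ.map.edgeOf c) 1 : _ → ZMod 2) (Φ.map.edgeOf s) = CombMap.ind c s := by
      intro c hc
      unfold CombMap.ind
      split_ifs with h3
      · rw [h3, Pi.single_eq_same]
      · refine Pi.single_eq_of_ne (fun h => ?_) _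
        rcases Φ.map.eq_or_eq_rev_of_edgeOf_eq h with h4 | h4
        · exact h3 h4.symm
        · rw [h4] at hc
          exact faceOf_rev_ne_outerFace hs hc
    rw [hx, Pi.add_apply, Pi.add_apply, Pi.single_eq_of_ne h1, zero_add, h2 a ha, h2 b hb]
  · have h1 : Φ.map.innerChanges Φ.outerFace x ⊆ {Φ.map.edgeOf t} := by
      rintro e ⟨he, hne⟩
      by_contra h2
      rw [hx, Pi.add_apply, Pi.add_apply, Pi.single_eq_of_ne h2, Pi.single_eq_of_ne,
        Pi.single_eq_of_ne] at hne
      · exact hne (by simp)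
      · rintro rfl
        exact he ⟨b, hb, rfl⟩
      · rintro rfl
        exact he ⟨a, ha, rfl⟩
    exact (Set.ncard_le_ncard h1).trans (by simp)

theorem ncard_crossChanges_le_index (y : Fin (2 * k) → ZMod 2) :
    (crossChanges y).ncard ≤ k := by
  have h := Set.ncard_le_ncard (Set.subset_univ (crossChanges y))
  rwa [Set.ncard_univ, Nat.card_fin] at h

/-- The inner edge at the common end of two edges of `C'` of weight `0` forces `5 ≤ k`, and for
`k = 5` it gives two cuts through these edges of `C'` that end on opposite sides. -/
theorem exists_opposite_cuts (hG : SignedGraph.MemSStar k G σ)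
    (hπ : SignedGraph.SwitchingEquiv G σ π) (hΦ : Φ.IsNormal) {b : D}
    (hb : Φ.map.faceOf b = Φ.outerFace) (hwb : Φ.weight b = 0)
    (hwc : Φ.weight (Φ.map.face b) = 0) :
    5 ≤ k ∧ (k = 5 → ∃ s s' : Φ.Seg,
      Φ.map.HasCut Φ.outerFace b (Φ.bdryDart (edgeIdx Φ.pos s)) 1 ∧
      Φ.map.HasCut Φ.outerFace (Φ.map.face b) (Φ.bdryDart (edgeIdx Φ.pos s')) 1 ∧
      (crossChanges fun a => pointAfter Φ.pos s a + pointAfter Φ.pos s' a).ncard = 5) := by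
  classical
  have := Fintype.ofFinite D
  set c := Φ.map.face b with hcdef
  set g := Φ.map.rot c
  have hc : Φ.map.faceOf c = Φ.outerFace := by rw [hcdef, CombMap.faceOf_face, hb]
  have hgin : Φ.map.edgeOf g ∉ Φ.map.faceEdges Φ.outerFace := edgeOf_rot_face_notMem hb
  obtain ⟨x, y, hxg, hxy⟩ := exists_equilibrated hG hπ hgin
  obtain ⟨hxb, hxc⟩ := coboundary_eq_zero_of_weight_eq_zero hG hπ hxy hb hwb hwc hxg
  have hfalse := fun {s} hs hsx {e} =>
    false_of_faceSum_eq_zero hG hπ hxy (c := s) hs hsx (e := e)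
  have hgc : Φ.map.faceOf g = Φ.map.faceOf (Φ.map.rev c) := Φ.map.faceOf_rot c
  have hgb : Φ.map.faceOf (Φ.map.rev g) = Φ.map.faceOf (Φ.map.rev b) :=
    Φ.isCubic.faceOf_rev_rot_face b
  have hbc : Φ.map.faceOf (Φ.map.rev c) ≠ Φ.map.faceOf (Φ.map.rev b) :=
    CombMap.faceOf_rev_face_ne Φ.isPlane Φ.isCubic Φ.isTwoConnected b
  have hbridge : ∀ t, Φ.map.faceOf (Φ.map.rev t) ≠ Φ.map.faceOf t :=
    CombMap.faceOf_rev_ne Φ.isPlane Φ.isCubic Φ.isTwoConnected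
  obtain ⟨t₁, ht₁g, ht₁f, ht₁⟩ := exists_inner_change hΦ hb hxb hgb (by rwa [Φ.map.edgeOf_rev])
  obtain ⟨t₂, ht₂g, ht₂f, ht₂⟩ := exists_inner_change hΦ hc hxc hgc hxg
  have hg : Φ.map.edgeOf g ∈ Φ.map.innerChanges Φ.outerFace x := ⟨hgin, hxg⟩
  have hne₁ : Φ.map.edgeOf g ≠ Φ.map.edgeOf t₁ := by
    intro h
    rcases Φ.map.eq_or_eq_rev_of_edgeOf_eq h with h1 | h1
    · exact hbc (by rw [← hgc, ← h1, ht₁f])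
    · exact ht₁g h1
  have hne₂ : Φ.map.edgeOf g ≠ Φ.map.edgeOf t₂ := by
    intro h
    rcases Φ.map.eq_or_eq_rev_of_edgeOf_eq h with h1 | h1
    · exact ht₂g h1
    · exact hbc (by rw [← hgb, ← h1, ht₂f])
  set A := Φ.map.faceOf (Φ.map.rev t₁) with hA
  set B := Φ.map.faceOf (Φ.map.rev t₂) with hB
  -- Otherwise `g` and `t₁` join the same two faces and form a dual 2-cycle.
  have hAc : A ≠ Φ.map.faceOf (Φ.map.rev c) := by
    intro h
    refine hfalse (s := Pi.single (Φ.map.edgeOf g) 1 + Pi.single (Φ.map.edgeOf t₁) 1) ?_ ?_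
      (e := Φ.map.edgeOf g) ?_
    · rw [map_add, CombMap.faceSum_single, CombMap.faceSum_single, hgc, hgb, ht₁f, ← hA, h,
        add_comm (Pi.single (Φ.map.faceOf (Φ.map.rev b)) 1), CombMap.fun_add_self]
    · intro e he
      by_contra hcon
      refine he ?_
      rw [Pi.add_apply, Pi.single_eq_of_ne, Pi.single_eq_of_ne, add_zero]
      · rintro rfl
        exact hcon ht₁
      · rintro rfl
        exact hcon hg
    · rw [Pi.add_apply, Pi.single_eq_same, Pi.single_eq_of_ne hne₁]
      decide
  have hBb : B ≠ Φ.map.faceOf (Φ.map.rev b) := by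
    intro h
    refine hfalse (s := Pi.single (Φ.map.edgeOf g) 1 + Pi.single (Φ.map.edgeOf t₂) 1) ?_ ?_
      (e := Φ.map.edgeOf g) ?_
    · rw [map_add, CombMap.faceSum_single, CombMap.faceSum_single, hgc, hgb, ht₂f, ← hB, h,
        CombMap.fun_add_self]
    · intro e he
      by_contra hcon
      refine he ?_
      rw [Pi.add_apply, Pi.single_eq_of_ne, Pi.single_eq_of_ne, add_zero]
      · rintro rfl
        exact hcon ht₂
      · rintro rfl
        exact hcon hg
    · rw [Pi.add_apply, Pi.single_eq_same, Pi.single_eq_of_ne hne₂]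
      decide
  have hne₁₂ : Φ.map.edgeOf t₁ ≠ Φ.map.edgeOf t₂ := by
    intro h
    rcases Φ.map.eq_or_eq_rev_of_edgeOf_eq h with h1 | h1
    · exact hbc (by rw [← ht₁f, ← h1, ht₂f])
    · exact hAc (by rw [hA, ← h1, ht₂f])
  -- Otherwise `g`, `t₁`, `t₂` form a dual triangle.
  have hAB : A ≠ B := by
    intro h
    refine hfalse (s := Pi.single (Φ.map.edgeOf g) 1 + Pi.single (Φ.map.edgeOf t₁) 1 +
      Pi.single (Φ.map.edgeOf t₂) 1) ?_ ?_ (e := Φ.map.edgeOf g) ?_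
    · rw [map_add, map_add, CombMap.faceSum_single, CombMap.faceSum_single,
        CombMap.faceSum_single, hgc, hgb, ht₁f, ht₂f, ← hA, ← hB, h]
      ext f
      simp only [Pi.add_apply, Pi.zero_apply]
      generalize (Pi.single (Φ.map.faceOf (Φ.map.rev c)) 1 : _ → ZMod 2) f = p
      generalize (Pi.single (Φ.map.faceOf (Φ.map.rev b)) 1 : _ → ZMod 2) f = q
      generalize (Pi.single B 1 : _ → ZMod 2) f = r
      revert p q r
      decide
    · intro e he
      by_contra hcon
      refine he ?_
      rw [Pi.add_apply, Pi.add_apply, Pi.single_eq_of_ne, Pi.single_eq_of_ne,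
        Pi.single_eq_of_ne, add_zero, add_zero]
      · rintro rfl
        exact hcon ht₂
      · rintro rfl
        exact hcon ht₁
      · rintro rfl
        exact hcon hg
    · rw [Pi.add_apply, Pi.add_apply, Pi.single_eq_same, Pi.single_eq_of_ne hne₁,
        Pi.single_eq_of_ne hne₂]
      decide
  have hsub : {Φ.map.edgeOf g, Φ.map.edgeOf t₁, Φ.map.edgeOf t₂} ⊆
      Φ.map.innerChanges Φ.outerFace x := by
    rintro e (rfl | rfl | rfl)
    · exact hg
    · exact ht₁
    · exact ht₂
  have hcard3 : ({Φ.map.edgeOf g, Φ.map.edgeOf t₁, Φ.map.edgeOf t₂} : Set _).ncard = 3 :=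
    Set.ncard_eq_three.mpr ⟨_, _, _, hne₁, hne₂, hne₁₂, rfl⟩
  have hinner := Set.ncard_le_ncard hsub
  rw [hcard3] at hinner
  have hcolour := eq_add_sum_change Φ.pos_mono (fun j => x (Φ.corner j)) y
  -- The number is even, and it is not 0: a colouring constant on the subdivided `C'` separates no
  -- pair, while three inner edges must be balanced.
  have hseg : 2 ≤ (Φ.segChanges x y).ncard := by
    have h1 := even_ncard_segChanges Φ.toCanonicalData x y
    by_contra h2
    have h3 : (Φ.segChanges x y).ncard = 0 := by
      rcases h1 with ⟨r, hr⟩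
      omega
    rw [Set.ncard_eq_zero] at h3
    have h4 : ∀ s, change Φ.pos (fun j => x (Φ.corner j)) y s = 0 := by
      intro s
      by_contra h5
      exact Set.notMem_empty s (h3 ▸ h5)
    have h5 : crossChanges y = ∅ := by
      ext a
      simp only [crossChanges, Set.mem_ofPred_eq, Set.mem_empty_iff_false, iff_false, not_not]
      rw [(eq_of_change_eq_zero h4).2, (eq_of_change_eq_zero h4).2, CharTwo.add_self_eq_zero]
    rw [h5, Set.ncard_empty] at hxy
    omega
  have hk := ncard_crossChanges_le_index y
  refine ⟨by omega, fun hk5 => ?_⟩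
  -- For `k = 5` the bound `3 + 2 ≤ 5` is tight, so there are no further changes.
  have hinner_eq : {Φ.map.edgeOf g, Φ.map.edgeOf t₁, Φ.map.edgeOf t₂} =
      Φ.map.innerChanges Φ.outerFace x :=
    Set.eq_of_subset_of_ncard_le hsub (by omega)
  obtain ⟨s, s', hss', hsegs⟩ := Set.ncard_eq_two.mp (show (Φ.segChanges x y).ncard = 2 by omega)
  have hsum : ∀ F : Φ.Seg → ZMod 2, ∑ r, change Φ.pos (fun j => x (Φ.corner j)) y r * F r =
      F s + F s' := by
    intro F
    have h1 : ∀ p : ZMod 2, p ≠ 0 → p = 1 := by decide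
    have h2 : change Φ.pos (fun j => x (Φ.corner j)) y s = 1 :=
      h1 _ (show s ∈ Φ.segChanges x y by rw [hsegs]; simp)
    have h3 : change Φ.pos (fun j => x (Φ.corner j)) y s' = 1 :=
      h1 _ (show s' ∈ Φ.segChanges x y by rw [hsegs]; simp)
    rw [← Finset.sum_subset (Finset.subset_univ {s, s'}), Finset.sum_pair hss', h2, h3, one_mul,
      one_mul]
    intro r _ hr
    by_contra h4
    have h5 : r ∈ Φ.segChanges x y := fun h6 => h4 (by
      rw [show change Φ.pos (fun j => x (Φ.corner j)) y r = 0 from h6, zero_mul])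
    rw [hsegs] at h5
    exact hr (by simpa using h5)
  -- By parity the face beyond `t` has a second changing edge. If that edge is not inner, it lies on
  -- `C'`, so it contains `s` or `s'`, the only segments that change.
  have hfar : ∀ t, Φ.map.edgeOf t ∈ Φ.map.innerChanges Φ.outerFace x →
      (∀ t', Φ.map.faceOf t' = Φ.map.faceOf (Φ.map.rev t) → t' ≠ Φ.map.rev t →
        Φ.map.edgeOf t' ∉ Φ.map.innerChanges Φ.outerFace x) →
      ∃ j : ℕ, (j = edgeIdx Φ.pos s ∨ j = edgeIdx Φ.pos s') ∧
        Φ.map.faceOf (Φ.map.rev t) = Φ.map.faceOf (Φ.map.rev (Φ.bdryDart j)) := by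
    intro t ht hno
    obtain ⟨t', hne, hf, hx'⟩ := CombMap.exists_ne_coboundary_ne_zero (M := Φ.map) x
      (t := Φ.map.rev t) (by rw [Φ.map.edgeOf_rev]; exact ht.2)
    have hout : Φ.map.edgeOf t' ∈ Φ.map.faceEdges Φ.outerFace := by
      by_contra h1
      exact hno t' hf hne ⟨h1, hx'⟩
    have hrev : Φ.map.faceOf (Φ.map.rev t') = Φ.outerFace := by
      obtain ⟨r, hr, hrt⟩ := hout
      rcases Φ.map.eq_or_eq_rev_of_edgeOf_eq hrt with h1 | h1
      · rw [h1, hr] at hf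
        exact absurd hf.symm (faceOf_ne_of_notMem ht.1).2
      · rw [h1, Φ.map.rev_rev, hr]
    obtain ⟨j, hj⟩ := exists_bdryDart_eq hrev
    refine ⟨j, ?_, by rw [hj, Φ.map.rev_rev, hf]⟩
    rw [← Φ.map.edgeOf_rev, ← hj, coboundary_bdryDart, hcolour.1 j j.2.le,
      hcolour.1 (j + 1) j.2, hsum, hsum] at hx'
    simp only [cornerAfter] at hx'
    by_contra! hcon
    apply hx'
    have h3 : ∀ i : ℕ, (j : ℕ) ≠ i → (if i < (j : ℕ) + 1 then (1 : ZMod 2) else 0) =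
        if i < (j : ℕ) then 1 else 0 := by
      intro i hi
      exact if_congr (by omega) rfl rfl
    rw [h3 _ hcon.1, h3 _ hcon.2, CharTwo.add_self_eq_zero]
  have hedge : ∀ t', Φ.map.edgeOf t' ∈ Φ.map.innerChanges Φ.outerFace x →
      t' = g ∨ t' = Φ.map.rev g ∨ t' = t₁ ∨ t' = Φ.map.rev t₁ ∨ t' = t₂ ∨ t' = Φ.map.rev t₂ := by
    intro t' ht'
    rw [← hinner_eq] at ht'
    rcases ht' with h | h | h
    · rcases Φ.map.eq_or_eq_rev_of_edgeOf_eq h.symm with h1 | h1 <;> simp [h1]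
    · rcases Φ.map.eq_or_eq_rev_of_edgeOf_eq h.symm with h1 | h1 <;> simp [h1]
    · rcases Φ.map.eq_or_eq_rev_of_edgeOf_eq h.symm with h1 | h1 <;> simp [h1]
  have hAb : A ≠ Φ.map.faceOf (Φ.map.rev b) := by
    rw [← ht₁f]
    exact hbridge t₁
  have hBc : B ≠ Φ.map.faceOf (Φ.map.rev c) := by
    rw [← ht₂f]
    exact hbridge t₂
  obtain ⟨i, hi, hiA⟩ := hfar t₁ ht₁ (by
    intro t' hf hne hin
    rw [← hA] at hf
    rcases hedge t' hin with rfl | rfl | rfl | rfl | rfl | rfl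
    · exact hAc (by rw [← hf, hgc])
    · exact hAb (by rw [← hf, hgb])
    · exact hAb (by rw [← hf, ht₁f])
    · exact hne rfl
    · exact hAc (by rw [← hf, ht₂f])
    · exact hAB hf.symm)
  obtain ⟨i', hi', hiB⟩ := hfar t₂ ht₂ (by
    intro t' hf hne hin
    rw [← hB] at hf
    rcases hedge t' hin with rfl | rfl | rfl | rfl | rfl | rfl
    · exact hBc (by rw [← hf, hgc])
    · exact hBb (by rw [← hf, hgb])
    · exact hBb (by rw [← hf, ht₁f])
    · exact hAB hf
    · exact hBc (by rw [← hf, ht₂f])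
    · exact hne rfl)
  have hcut₁ : Φ.map.HasCut Φ.outerFace b (Φ.bdryDart i) 1 :=
    hasCut_one hb (faceOf_bdryDart i) ht₁.1 ht₁f hiA
  have hcut₂ : Φ.map.HasCut Φ.outerFace c (Φ.bdryDart i') 1 :=
    hasCut_one hc (faceOf_bdryDart i') ht₂.1 ht₂f hiB
  have hii' : i ≠ i' := by
    rintro rfl
    exact hAB (hiA.trans hiB.symm)
  have hcross : (crossChanges fun a => pointAfter Φ.pos s a + pointAfter Φ.pos s' a).ncard = 5 := by
    rw [← crossChanges_congr (x (Φ.corner 0)) (fun a => (hcolour.2 a).trans (by rw [hsum]))]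
    omega
  rcases hi with rfl | rfl
  · rcases hi' with rfl | rfl
    · exact absurd rfl hii'
    · exact ⟨s, s', hcut₁, hcut₂, hcross⟩
  · rcases hi' with rfl | rfl
    · refine ⟨s', s, hcut₁, hcut₂, ?_⟩
      simpa only [add_comm] using hcross
    · exact absurd rfl hii'

end CanonicalEmbedding

/-! ### Four consecutive edges of weight 0 for `k = 5` -/

namespace CombMap

theorem HasCut.refl {D : Type*} (M : CombMap D) (f : M.Face) (b : D) : M.HasCut f b b 0 := by
  refine ⟨0, fun t _ => ?_, ?_⟩
  · rw [map_zero, CharTwo.add_self_eq_zero]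
    rfl
  · simp [innerChanges]

end CombMap

/-- An interval of `δ` of the ten cyclically ordered points separates `min δ (10 - δ)` of the five
opposite pairs; this is checked over all pairs of end positions. -/
theorem SubdividedCycle.crossChanges_pointAfter {m : ℕ} {pos : Fin (2 * 5) → Fin m}
    (s s' : Fin m ⊕ Fin (2 * 5)) :
    (CanonicalData.crossChanges fun a => pointAfter pos s a + pointAfter pos s' a).ncard =
      min (numBefore pos s - numBefore pos s' + (numBefore pos s' - numBefore pos s))
        (10 - (numBefore pos s - numBefore pos s' + (numBefore pos s' - numBefore pos s))) := by
  have h : ∀ p < 11, ∀ q < 11, (Finset.univ.filter fun a : Fin 5 =>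
      ¬ (((p ≤ (a : ℕ)) ↔ (q ≤ (a : ℕ))) ↔ ((p ≤ (a : ℕ) + 5) ↔ (q ≤ (a : ℕ) + 5)))).card =
      min (p - q + (q - p)) (10 - (p - q + (q - p))) := by
    decide
  rw [← h _ (Nat.lt_succ_of_le (numBefore_le s)) _ (Nat.lt_succ_of_le (numBefore_le s')),
    ← Set.ncard_coe_finset]
  congr 1
  ext a
  simp only [CanonicalData.crossChanges, pointAfter, Set.mem_ofPred_eq, Finset.coe_filter,
    Finset.mem_univ, true_and]
  by_cases h1 : numBefore pos s ≤ a <;> by_cases h2 : numBefore pos s' ≤ a <;>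
    by_cases h3 : numBefore pos s ≤ a + 5 <;> by_cases h4 : numBefore pos s' ≤ a + 5 <;>
    simp [h1, h2, h3, h4, CharTwo.add_self_eq_zero]

namespace CanonicalEmbedding

variable {α β D : Type*} [Finite D] {G : Graph α β} {σ π : β → ℤˣ}

open SubdividedCycle CanonicalData

/-- By parity the face across `b` has another changing edge, and by normality this edge is not on
`C'`; so an inner edge is needed. -/
theorem not_hasCut_zero {k : ℕ} {Φ : CanonicalEmbedding G π k D} (hΦ : Φ.IsNormal) {b b' : D}
    (hb : Φ.map.faceOf b = Φ.outerFace) (hne : b ≠ b') : ¬ Φ.map.HasCut Φ.outerFace b b' 0 := by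
  rintro ⟨x, hx, hn⟩
  have h1 := hx b hb
  simp only [CombMap.ind, if_pos, if_neg hne, add_zero] at h1
  obtain ⟨t, htne, htf, htx⟩ := CombMap.exists_ne_coboundary_ne_zero (M := Φ.map) x
    (t := Φ.map.rev b) (by rw [Φ.map.edgeOf_rev, h1]; exact one_ne_zero)
  rw [Nat.le_zero, Set.ncard_eq_zero] at hn
  have hout : Φ.map.edgeOf t ∈ Φ.map.faceEdges Φ.outerFace := by
    by_contra h2
    exact Set.notMem_empty (Φ.map.edgeOf t) (hn ▸ ⟨h2, htx⟩)
  obtain ⟨r, hr, hrt⟩ := hout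
  rcases Φ.map.eq_or_eq_rev_of_edgeOf_eq hrt with h2 | h2
  · rw [h2, hr] at htf
    exact faceOf_rev_ne_outerFace hb htf.symm
  · refine htne ?_
    rw [h2, hΦ.eq_of_faceOf_rev_eq hr hb (by rw [← h2, htf])]

/-- For `k = 5`, no four consecutive edges of `C'` have weight `0`. -/
theorem not_four_weights_eq_zero {Φ : CanonicalEmbedding G π 5 D}
    (hG : SignedGraph.MemSStar 5 G σ) (hπ : SignedGraph.SwitchingEquiv G σ π) (hΦ : Φ.IsNormal)
    {d : D} (hd : Φ.map.faceOf d = Φ.outerFace)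
    (hw : ∀ j < 4, Φ.weight (Φ.map.face^[j] d) = 0) : False := by
  obtain ⟨r, rfl⟩ := exists_bdryDart_eq hd
  obtain ⟨m, hm⟩ : ∃ m, m = Function.minimalPeriod Φ.map.face Φ.root := ⟨_, rfl⟩
  have hmd : Function.minimalPeriod Φ.map.face (Φ.bdryDart r) = m := by
    rw [hm]
    exact Function.minimalPeriod_apply_iterate
      (Function.minimalPeriod_pos_iff_mem_periodicPts.mp (CombMap.minimalPeriod_face_pos _)) _
  have hface : ∀ j, Φ.map.faceOf (Φ.map.face^[j] (Φ.bdryDart r)) = Φ.outerFace :=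
    fun j => (CombMap.faceOf_iterate _ _).trans hd
  -- indices and numbers of points relative to the dart `bdryDart r`
  set φ : Φ.Seg → ℕ := numBefore Φ.pos
  set idx : Φ.Seg → ℕ := edgeIdx Φ.pos
  set φ₀ := φ (.inl r)
  have hφ₀le : φ₀ ≤ 10 := numBefore_le _
  have hidx_lt : ∀ s, idx s < m := fun s => hm ▸ edgeIdx_lt s
  have hφle : ∀ s, φ s ≤ 10 := numBefore_le
  have hr : (r : ℕ) < m := hm ▸ r.2
  have hpos_lt : ∀ a, (Φ.pos a : ℕ) < m := fun a => hm ▸ (Φ.pos a).2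
  have hφ₀iff : ∀ a : Fin (2 * 5), φ₀ ≤ a ↔ (r : ℕ) ≤ Φ.pos a :=
    fun a => numBefore_inl_le_iff Φ.pos_mono
  -- Numbers smaller than `r` are reached only after passing `root`, which adds all `m` edges to
  -- `rel` and all 10 points to `ψ`.
  let rel : ℕ → ℕ := fun i => if (r : ℕ) ≤ i then i - r else i + m - r
  let ψ : Φ.Seg → ℕ := fun s => if (r : ℕ) ≤ idx s then φ s - φ₀ else φ s + 10 - φ₀
  have hrel : ∀ i < m, Φ.map.face^[rel i] (Φ.bdryDart r) = Φ.bdryDart i := by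
    intro i hi
    change Φ.map.face^[rel i] (Φ.map.face^[r] Φ.root) = Φ.map.face^[i] Φ.root
    rw [← Function.iterate_add_apply]
    simp only [rel]
    split_ifs with h
    · rw [Nat.sub_add_cancel h]
    · rw [Nat.sub_add_cancel (by omega), hm, Function.iterate_add_minimalPeriod_eq]
  have hrel_lt : ∀ i < m, rel i < m := by
    intro i hi
    simp only [rel]
    split_ifs <;> omega
  have hpos : ∀ a, 4 ≤ rel (Φ.pos a) := by
    intro a
    by_contra! h
    refine pos_ne_of_weight_eq_zero (j := Φ.pos a) (a := a) ?_ rfl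
    rw [← hrel _ (hpos_lt a)]
    exact hw _ h
  have hle : ∀ s, (r : ℕ) ≤ idx s → φ₀ ≤ φ s := by
    intro s hs
    by_contra! h
    have h1 := le_pos_of_le Φ.pos_mono (s := s) (a := ⟨φ s, by omega⟩) le_rfl
    have h2 := (hφ₀iff ⟨φ s, by omega⟩).mpr (hs.trans h1)
    exact absurd h2 (not_le.mpr h)
  have hge : ∀ s, idx s < (r : ℕ) → φ s ≤ φ₀ := by
    intro s hs
    by_contra! h
    have h3 := hφle s
    have h1 := pos_le_of_lt Φ.pos_mono (s := s) (a := ⟨φ₀, by omega⟩) h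
    have h2 := (hφ₀iff ⟨φ₀, by omega⟩).mp le_rfl
    have h4 : edgeIdx Φ.pos s = idx s := rfl
    omega
  have hψle : ∀ s, ψ s ≤ 10 := by
    intro s
    have h1 := hφle s
    have h2 := hge s
    simp only [ψ]
    split_ifs <;> omega
  have hψmono : ∀ s s', rel (idx s) < rel (idx s') → ψ s ≤ ψ s' := by
    intro s s' h
    have h1 := numBefore_mono Φ.pos_mono (s := s) (t := s')
    have h2 := hle s
    have h3 := hle s'
    have h4 := hge s
    have h5 := hge s'
    have h6 := hφle s
    have h7 := hidx_lt s
    have h8 := hidx_lt s'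
    change idx s < idx s' → φ s ≤ φ s' at h1
    revert h
    simp only [ψ, rel]
    split_ifs <;> omega
  have hψzero : ∀ s, rel (idx s) < 4 → ψ s = 0 := by
    intro s h
    have h1 := hidx_lt s
    have h2 := hφle s
    by_cases hs : (r : ℕ) ≤ idx s
    · simp only [rel, ψ, if_pos hs] at h ⊢
      by_contra h3
      have h4 := pos_le_of_lt Φ.pos_mono (s := s) (a := ⟨φ₀, by omega⟩) (by
        change φ₀ < φ s
        omega)
      change _ ≤ idx s at h4
      have h5 := (hφ₀iff ⟨φ₀, by omega⟩).mp le_rfl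
      have h6 := hpos ⟨φ₀, by omega⟩
      simp only [rel, if_pos h5] at h6
      omega
    · simp only [rel, ψ, if_neg hs] at h ⊢
      -- The run passes `root`, so every edge numbered from `r` on belongs to it and carries no
      -- point.
      have h3 : φ₀ = 10 := by
        by_contra h3
        have h5 := (hφ₀iff ⟨φ₀, by omega⟩).mp le_rfl
        have h6 := hpos ⟨φ₀, by omega⟩
        have h7 := hpos_lt ⟨φ₀, by omega⟩
        simp only [rel, if_pos h5] at h6
        omega
      by_contra h4
      have h5 := pos_le_of_lt Φ.pos_mono (s := s) (a := ⟨0, by omega⟩) (by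
        change 0 < φ s
        omega)
      change _ ≤ idx s at h5
      have h6 := hpos ⟨0, by omega⟩
      simp only [rel] at h6
      rw [if_neg (by omega)] at h6
      omega
  have hm4 : 4 < m := (hpos ⟨0, by omega⟩).trans_lt (hrel_lt _ (hpos_lt _))
  -- cuts between two places on `C'`
  let H : ℕ → ℕ → ℕ → Prop := fun i j n => Φ.map.HasCut Φ.outerFace
    (Φ.map.face^[i] (Φ.bdryDart r)) (Φ.map.face^[j] (Φ.bdryDart r)) n
  have hcross : ∀ s s', (crossChanges fun a => pointAfter Φ.pos s a + pointAfter Φ.pos s' a).ncard =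
      min (ψ s - ψ s' + (ψ s' - ψ s)) (10 - (ψ s - ψ s' + (ψ s' - ψ s))) := by
    intro s s'
    rw [crossChanges_pointAfter]
    change min (φ s - φ s' + (φ s' - φ s)) (10 - (φ s - φ s' + (φ s' - φ s))) = _
    have h2 := hle s
    have h3 := hle s'
    have h4 := hge s
    have h5 := hge s'
    have h6 := hφle s
    have h7 := hφle s'
    simp only [ψ]
    split_ifs <;> omega
  have hbound : ∀ s s' n, H (rel (idx s)) (rel (idx s')) n →
      min (ψ s - ψ s' + (ψ s' - ψ s)) (10 - (ψ s - ψ s' + (ψ s' - ψ s))) ≤ n + 2 := by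
    intro s s' n h
    simp only [H] at h
    rw [hrel _ (hidx_lt s), hrel _ (hidx_lt s')] at h
    rw [← hcross]
    exact crossChanges_le_of_hasCut hG hπ h
  have hrun : ∀ j < 4, ∃ s, rel (idx s) = j ∧ ψ s = 0 := by
    intro j hj
    obtain ⟨i, hi⟩ := exists_bdryDart_eq (hface j)
    have h1 : rel (idx (.inl i)) = j := by
      change rel i = j
      have hi_lt : (i : ℕ) < m := hm ▸ i.2
      rw [← hrel _ hi_lt] at hi
      exact (CombMap.iterate_inj (by rw [hmd]; exact hrel_lt _ hi_lt) (by omega)).mp hi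
    exact ⟨.inl i, h1, hψzero _ (by omega)⟩
  -- Edge `j` of the run has no points before it, so the pairs separated are counted by `ψ s` alone;
  -- at most `1 + 2` positive edges are available. This excludes the values 4, 5, 6 of `ψ s`.
  have hbound0 : ∀ j < 4, ∀ s, H j (rel (idx s)) 1 → min (ψ s) (10 - ψ s) ≤ 3 := by
    intro j hj s h
    obtain ⟨e, he, he0⟩ := hrun j hj
    rw [← he] at h
    have h1 := hbound e s 1 h
    omega
  have hpair : ∀ j < 3, ∃ p q, H j (rel (idx p)) 1 ∧ H (j + 1) (rel (idx q)) 1 ∧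
      4 ≤ rel (idx p) ∧ ψ p = ψ q + 5 ∧ (ψ p = 7 ∨ ψ p = 8) := by
    intro j hj
    obtain ⟨p, q, hp, hq, hpq⟩ := (exists_opposite_cuts hG hπ hΦ (hface j) (hw j (by omega))
      (by rw [← Function.iterate_succ_apply' Φ.map.face j]; exact hw (j + 1) (by omega))).2 rfl
    rw [← Function.iterate_succ_apply' Φ.map.face j] at hq
    have hp' : H j (rel (idx p)) 1 := by
      simp only [H]
      rwa [hrel _ (hidx_lt p)]
    have hq' : H (j + 1) (rel (idx q)) 1 := by
      simp only [H]
      rwa [hrel _ (hidx_lt q)]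
    rw [hcross] at hpq
    have h1 := hbound0 j (by omega) p hp'
    have h2 := hbound0 (j + 1) (by omega) q hq'
    have h3 := hψle p
    have h4 := hψle q
    have hp4 : 4 ≤ rel (idx p) := by
      by_contra! h
      have := hψzero p h
      omega
    refine ⟨p, q, hp', hq', hp4, ?_⟩
    by_cases hlt : ψ q < ψ p
    · omega
    exfalso
    have h5 : rel (idx p) ≤ rel (idx q) := by
      by_contra! h
      have := hψmono q p h
      omega
    rcases h5.eq_or_lt with h6 | h6
    · have h7 := hbound p q 0 (by rw [← h6]; exact CombMap.HasCut.refl _ _ _)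
      omega
    · have h8 := hrel_lt _ (hidx_lt q)
      simp only [H, ← hd] at hp' hq'
      -- If `p` comes before `q`, the two cuts cross. Their differences give a cut from `p` to `q`
      -- with at most 2 inner edges, hence at most 4 positive ones against 5 separated pairs.
      obtain ⟨a, b, hab, -, hb⟩ := CombMap.HasCut.uncross_sdiff (by omega) (by omega) h6
        (by omega) hp' hq'
      rw [hd] at hb
      have h7 := hbound p q b hb
      omega
  have hstep : ∀ j < 2, ∀ p q p', H j (rel (idx p)) 1 → H (j + 1) (rel (idx q)) 1 →
      H (j + 1) (rel (idx p')) 1 → 4 ≤ rel (idx p) → ψ p = ψ q + 5 → ψ p' < ψ p := by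
    intro j hj p q p' hp hq hp' hp4 hpq
    -- Composed with the cut from `j + 1` to `q`, it would give a cut from `p` to `q` with 2 inner
    -- edges, too few for 5 pairs.
    have htri : ¬ H (j + 1) (rel (idx p)) 1 := by
      intro h
      have h1 := hbound p q 2 (h.symm.trans hq)
      omega
    by_contra! hlt
    have h1 : rel (idx p) ≤ rel (idx p') := by
      by_contra! h
      have h2 := hψmono p' p h
      have h3 := hbound p' q 2 (hp'.symm.trans hq)
      omega
    rcases h1.eq_or_lt with h2 | h2
    · rw [← h2] at hp'
      exact htri hp'
    · have h8 := hrel_lt _ (hidx_lt p')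
      simp only [H, ← hd] at hp hp'
      -- The union, a cut from `j` to `p'`, needs an inner edge by normality. That leaves at most
      -- one for the intersection, a cut from `j + 1` to `p`, which `htri` forbids.
      obtain ⟨a, b, hab, ha, hb⟩ := CombMap.HasCut.uncross_inter_union (by omega) (by omega) h2
        (by omega) hp hp'
      rw [hd] at ha hb
      have hb0 : b ≠ 0 := by
        rintro rfl
        refine not_hasCut_zero hΦ (hface j) ?_ hb
        rw [Ne, CombMap.iterate_inj (by omega) (by omega)]
        omega
      exact htri (ha.mono (by omega))
  -- Four edges yield three consecutive pairs, hence three strictly decreasing values of `ψ`, all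
  -- equal to 7 or 8.
  obtain ⟨p₀, q₁, hp₀, hq₁, hp₀4, hpq₀, h₀⟩ := hpair 0 (by omega)
  obtain ⟨p₁, q₂, hp₁, hq₂, hp₁4, hpq₁, h₁⟩ := hpair 1 (by omega)
  obtain ⟨p₂, q₃, hp₂, hq₃, hp₂4, hpq₂, h₂⟩ := hpair 2 (by omega)
  have h3 := hstep 0 (by omega) p₀ q₁ p₁ hp₀ hq₁ hp₁ hp₀4 hpq₀
  have h4 := hstep 1 (by omega) p₁ q₂ p₂ hp₁ hq₂ hp₂ hp₁4 hpq₁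
  omega

end CanonicalEmbedding

theorem proposition2p11 {α β D : Type*} [Finite D] (k : ℕ) (G : Graph α β) (σ π : β → ℤˣ)
    (hG : SignedGraph.MemSStar k G σ) (hπ : SignedGraph.SwitchingEquiv G σ π)
    (Φ : CanonicalEmbedding G π k D) (hΦ : Φ.IsNormal) :
    (k = 4 → ∀ d, Φ.map.faceOf d = Φ.outerFace →
      ¬ (Φ.weight d = 0 ∧ Φ.weight (Φ.map.face d) = 0)) ∧
    (k = 5 → ∀ d, Φ.map.faceOf d = Φ.outerFace →
      ∀ n : ℕ, (∀ j < n, Φ.weight (Φ.map.face^[j] d) = 0) → n ≤ 3) := by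
  constructor
  · rintro hk d hd ⟨h1, h2⟩
    have h3 := (CanonicalEmbedding.exists_opposite_cuts hG hπ hΦ hd h1 h2).1
    omega
  · rintro rfl d hd n hn
    by_contra! h
    exact CanonicalEmbedding.not_four_weights_eq_zero hG hπ hΦ hd fun j hj => hn j (by omega)
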